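/- Let $m\ge 4$ be even, and let $d,r$ be integers with $2\le d\le 2r$. Then there is a $d$-polytope $X\subset\mathbb R^d$ whose $(\lfloor d/2\rfloor-1)$-skeleton is combinatorially isomorphic (isomorphic as a poset of faces, ordered by inclusion) to that of the $r$-fold product of $m$-gons. (All $m$-gons are combinatorially equivalent; take the regular one.) Moreover, $X$ can be chosen as the image $X=\pi_d(P)$ of a polytope $P\subset\mathbb R^{2r}$ under the projection $\pi_d$ to the last $d$ coordinates, where $P$ is a deformed product of $m$-gons of the following form. * There are points $q_1,\dots,q_{2r-1}\in\mathbb R^{d-2}$ in general position (any $d-1$ of them are affinely independent) which form a neighborly $(d-2)$-polytope: any at most $\lfloor (d-2)/2\rfloor$ of them are exactly those of the $2r-1$ points at which some linear functional attains its maximum over these points. (For $d=2$ this is one point repeated $2r-1$ times, for $d=3$ a set of $2r-1$ distinct points on a line.) They have a Gale transform of the form $G=\begin{pmatrix} I_{2r-d}\\ \overline G\end{pmatrix}\in\mathbb R^{(2r-1)\times(2r-d)}$, i.e. the columns of $G$ form a basis of $\{w\in\mathbb R^{2r-1}:\sum_k w_k=0,\ \sum_k w_kq_k=0\}$. Let $G_1,\dots,G_{2r-1}$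 be the rows of $G$. * There are $\varepsilon>0$ and $b_0,\dots,b_{m-1}>0$ such that, with $a_0=(-1,0)$, $a_i=\bigl(1,\varepsilon\frac{m-2i}{m-2}\bigr)$ for $1\le i\le m-1$, and $s_i=\varepsilon$ for even $i$, $s_i=1$ for odd $i$, the inequalities $s_ia_i^{\mathsf T}x\le s_ib_i$ $(0\le i\le m-1)$ define a convex $m$-gon in $\mathbb R^2$. Let $A\in\mathbb R^{m\times 2}$ be the matrix with rows $s_ia_i$. * There are $M_0,\dots,M_{r-1}>0$ such that $P$ is the set of all $x\in\mathbb R^{2r}$ satisfying, for $0\le j\le r-1$ and $0\le i\le m-1$, the inequality with right-hand side $M_js_ib_i$ and with the following coefficients: with the coordinates of $x$ numbered $0,\dots,2r-1$, the coordinates $2j,2j+1$ have as coefficients the $i$-th row of $A$; a coordinate $c<\min(2j,2r-d)$ has as coefficient the entry of $G_{2j}$ (if $i$ is even), respectively of $G_{2j+1}$ (if $i$ is odd), in the column of number $c$, where the columns of $G$ are numbered $0,\dots,2r-d-1$; all other coefficients are $0$. * $P$ is a $2r$-polytope combinatorially equivalent to the $r$-fold product of $m$-gons. -/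

import Mathlib

namespace PDPP

/-! ### Polytopes, faces, skeleta -/

section Polytopes

variable {E : Type*} [AddCommGroup E] [Module ℝ E]

/-- A (nonempty) convex polytope: the convex hull of a nonempty finite point set. -/
def IsPolytope (P : Set E) : Prop :=
  ∃ s : Finset E, s.Nonempty ∧ P = convexHull ℝ (s : Set E)

/-- The dimension of a nonempty convex set: the dimension of its affine span. -/
noncomputable def polyDim (P : Set E) : ℕ :=
  Module.finrank ℝ (vectorSpan ℝ P)

/-- A convex `m`-gon: a 2-dimensional polytope with exactly `m` vertices. -/
def IsPolygon (m : ℕ) (P : Set E) : Prop :=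
  IsPolytope P ∧ polyDim P = 2 ∧ (P.extremePoints ℝ).ncard = m

variable [TopologicalSpace E]

/-- The face lattice of `P`, ordered by inclusion. A face is the empty set or the set of points of
`P` at which some linear functional attains its maximum over `P` (so `P` itself is a face). -/
abbrev FaceLattice (P : Set E) : Type _ :=
  {F : Set E // IsExposed ℝ P F}

/-- The face poset of the `k`-skeleton of `P` (`k ≥ 0`): all faces of `P` of dimension at most `k`,
ordered by inclusion. The empty face (of dimension `-1`) belongs to every skeleton. -/
abbrev Skeleton (k : ℕ) (P : Set E) : Type _ :=
  {F : Set E // IsExposed ℝ P F ∧ polyDim F ≤ k}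

variable {E' : Type*} [AddCommGroup E'] [Module ℝ E'] [TopologicalSpace E']

/-- Two polytopes are combinatorially equivalent: their face lattices are isomorphic. -/
def CombEquiv (P : Set E) (P' : Set E') : Prop :=
  Nonempty (FaceLattice P ≃o FaceLattice P')

/-- The `k`-skeleta of two polytopes are combinatorially isomorphic. -/
def SkeletonIso (k : ℕ) (P : Set E) (P' : Set E') : Prop :=
  Nonempty (Skeleton k P ≃o Skeleton k P')

end Polytopes

/-- The regular `m`-gon inscribed in the unit circle of the plane. -/
noncomputable def regularPolygon (m : ℕ) : Set (Fin 2 → ℝ) :=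
  convexHull ℝ (Set.range fun k : Fin m =>
    ![Real.cos (2 * Real.pi * (k : ℝ) / m), Real.sin (2 * Real.pi * (k : ℝ) / m)])

/-- The `r`-fold product of `m`-gons, in `(ℝ²)^r`. -/
noncomputable def polygonProduct (m r : ℕ) : Set (Fin r → Fin 2 → ℝ) :=
  Set.univ.pi fun _ => regularPolygon m

/-! ### Neighborly polytopes and Gale transforms -/

/-- `Q` lists the vertices of a neighborly `D`-polytope in general position: any `D + 1` of the
points are affinely independent, and any at most `⌊D/2⌋` of them form a face of their convex hull,
that is, they are exactly the points of the list at which some linear functional attains its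
maximum. For `D ≥ 2` the points are therefore distinct and are the vertices of their convex hull.
For `D = 0, 1` the second condition is empty and `Q` is a point configuration: a repeated point for
`D = 0`, pairwise distinct points on a line for `D = 1`. -/
def IsNeighborlyGP {N D : ℕ} (Q : Fin N → Fin D → ℝ) : Prop :=
  (∀ s : Finset (Fin N), s.card = D + 1 → AffineIndependent ℝ fun i : s => Q i) ∧
  ∀ s : Finset (Fin N), s.card ≤ D / 2 →
    ∃ (l : (Fin D → ℝ) →ₗ[ℝ] ℝ) (c : ℝ), (∀ i ∈ s, l (Q i) = c) ∧ ∀ i ∉ s, l (Q i) < c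

/-- `G` is a Gale transform of the points `Q`: its columns form a basis of the orthogonal complement
of the column span of the matrix `(Q, 𝟙)`, whose rows are the homogenized points. -/
def IsGaleTransform {N D k : ℕ} (Q : Fin N → Fin D → ℝ) (G : Matrix (Fin N) (Fin k) ℝ) : Prop :=
  LinearIndependent ℝ (fun j : Fin k => fun i : Fin N => G i j) ∧
  ∀ w : Fin N → ℝ, w ∈ Submodule.span ℝ (Set.range fun j : Fin k => fun i : Fin N => G i j) ↔
    (∑ i, w i = 0 ∧ ∑ i, w i • Q i = 0)

/-- The matrix obtained by stacking the identity matrix of size `2r - d` on top of the rows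
`g 0, …, g (d - 2)`. -/
def stack {r d : ℕ} (g : Matrix (Fin (d - 1)) (Fin (2 * r - d)) ℝ) :
    Matrix (Fin (2 * r - 1)) (Fin (2 * r - d)) ℝ := fun i j =>
  if h : (i : ℕ) < 2 * r - d then (if (i : ℕ) = (j : ℕ) then 1 else 0)
  else g ⟨(i : ℕ) - (2 * r - d), by have := i.isLt; omega⟩ j

/-! ### The special polygons and their deformed products -/

/-- Even-indexed inequalities of the special polygon are scaled by `ε`. -/
def scale (ε : ℝ) {m : ℕ} (i : Fin m) : ℝ :=
  if Even (i : ℕ) then ε else 1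

/-- The scaled normals of the special `m`-gon: the vectors `a₀ = (-1, 0)` and
`aᵢ = (1, ε (m - 2i) / (m - 2))` for `1 ≤ i ≤ m - 1`, the even-indexed ones multiplied by `ε`. -/
noncomputable def polygonMatrix (m : ℕ) (ε : ℝ) : Matrix (Fin m) (Fin 2) ℝ := fun i =>
  scale ε i •
    (if (i : ℕ) = 0 then ![-1, 0] else ![1, ε * (((m : ℝ) - 2 * (i : ℝ)) / ((m : ℝ) - 2))])

/-- The special polygon: it is given by the inequalities `⟨aᵢ, x⟩ ≤ bᵢ`, the even-indexed ones
multiplied by `ε`. -/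
noncomputable def specialPolygon (m : ℕ) (ε : ℝ) (b : Fin m → ℝ) : Set (Fin 2 → ℝ) :=
  {x | ∀ i, (polygonMatrix m ε).mulVec x i ≤ scale ε i * b i}

/-- The left hand side matrix of the deformed product of `r` special `m`-gons. Its rows are indexed
by pairs (polygon `j`, edge `i`), its columns `2j, 2j + 1` belong to the polygon `j`. It is lower
triangular in blocks, all diagonal blocks are `polygonMatrix m ε`. To the left of the diagonal
block, only the first `2r - d` columns are nonzero, and there the rows of the polygon `j ≥ 1` are
alternatingly (even edges, odd edges) the rows `2j - 1` and `2j` (counted from `0`) of the matrix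
`stack g`. That is, an identity row contributes the single entry `1` in the last column
before the block `j` at the even edges and nothing at the odd edges, the other rows contribute the
full vectors `g 0, …, g (d - 2)`. -/
noncomputable def dppMatrix (m r d : ℕ) (ε : ℝ) (g : Matrix (Fin (d - 1)) (Fin (2 * r - d)) ℝ) :
    Matrix (Fin r × Fin m) (Fin (2 * r)) ℝ := fun p c =>
  if (c : ℕ) / 2 = (p.1 : ℕ) then
    polygonMatrix m ε p.2 ⟨(c : ℕ) % 2, Nat.mod_lt _ (by norm_num)⟩
  else if h : (c : ℕ) / 2 < (p.1 : ℕ) ∧ (c : ℕ) < 2 * r - d then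
    stack g ⟨2 * (p.1 : ℕ) + (p.2 : ℕ) % 2 - 1, by have := p.1.isLt; omega⟩ ⟨(c : ℕ), h.2⟩
  else 0

/-- The (iterated) deformed product of `r` special `m`-gons: the right hand side of the polygon `j`
is rescaled by the factor `M j`. -/
noncomputable def dpp (m r d : ℕ) (ε : ℝ) (g : Matrix (Fin (d - 1)) (Fin (2 * r - d)) ℝ)
    (b : Fin m → ℝ) (M : Fin r → ℝ) : Set (Fin (2 * r) → ℝ) :=
  {x | ∀ p : Fin r × Fin m, (dppMatrix m r d ε g).mulVec x p ≤ M p.1 * (scale ε p.2 * b p.2)}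

/-- The projection of `ℝⁿ` to the last `d` coordinates. -/
def projLast {n d : ℕ} (h : d ≤ n) (x : Fin n → ℝ) : Fin d → ℝ :=
  fun i => x ⟨n - d + (i : ℕ), by have := i.isLt; omega⟩

end PDPP

/-!
The polytope is obtained by deforming the product of `r` special `m`-gons so that a projection to
`ℝ^d` keeps all its faces of dimension at most `d / 2 - 1`.

*Faces.* The face poset of a polyhedron `{x | ∀ i, n i x ≤ β i}` is determined by the sets of
inequalities that are tight at its points (`exists_eq_hFace_of_isExposed`). For a product of `m`-gons
these are the sets that contain, in each factor, at most two edges, which are adjacent. In the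
deformed product the coordinates of one factor range over a polygon whose right hand sides are
perturbed by the coordinates of the previous factors. If the factors `M j` grow fast enough, the
perturbations are relatively small, and as the combinatorics of a polygon is stable
(`IsNGon.exists_perturbation`), the deformed product has the same tight sets
(`exists_hasIncidences_dpp`), hence an isomorphic face lattice (`HasIncidences.combEquiv`).

*Preserved faces.* A face is the preimage of a face of the projection if some positive combination
of its normals vanishes in the deleted coordinates (`exists_isPreserved`). As `ε` tends to `0`, the
normals at a vertex, restricted to the deleted coordinates, converge to a zero row together with the
rows of the Gale transform: `m` is even, so the two edges at a vertex of a polygon have different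
parities and contribute different rows. A face of dimension at most `d / 2 - 1` misses at most
`d / 2 - 1` of these rows. The corresponding points are the vertices of a face of the neighborly
polytope, so by Gale duality the remaining rows are positively dependent. They also span, by general
position, so the positive dependence survives for small `ε` (`exists_pos_vecMul_eq_zero`). The
points are taken on the moment curve, where Lagrange interpolation gives the Gale transform.

*No other faces.* A face of the projection of dimension at most `d / 2 - 1` that does not come from
a face of the same dimension would properly contain the image of a preserved face of dimension
`d / 2 - 1`, which is impossible (`HasIncidences.skeletonIso_image`). All dimensions are computed
from the fact that they increase strictly along chains of faces (`polyDim_add_card_le`).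
-/

namespace PDPP

/-! ### Faces of polyhedra given by inequalities -/

section HPolyhedron

open Filter Topology

variable {ι E : Type*} [AddCommGroup E] [Module ℝ E]

/-- The polyhedron given by the inequalities `n i x ≤ β i`. -/
def hPolyhedron (n : ι → E →ₗ[ℝ] ℝ) (β : ι → ℝ) : Set E := {x | ∀ i, n i x ≤ β i}

/-- The points of the polyhedron at which all inequalities in `J` are tight. -/
def hFace (n : ι → E →ₗ[ℝ] ℝ) (β : ι → ℝ) (J : Finset ι) : Set E :=
  {x | x ∈ hPolyhedron n β ∧ ∀ i ∈ J, n i x = β i}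

/-- `x` is a point of the polyhedron whose set of tight inequalities is exactly `J`. -/
def HasActiveSet (n : ι → E →ₗ[ℝ] ℝ) (β : ι → ℝ) (x : E) (J : Finset ι) : Prop :=
  x ∈ hPolyhedron n β ∧ ∀ i, n i x = β i ↔ i ∈ J

variable {n : ι → E →ₗ[ℝ] ℝ} {β : ι → ℝ}

theorem HasActiveSet.mem_hFace {x : E} {J : Finset ι} (h : HasActiveSet n β x J) :
    x ∈ hFace n β J := ⟨h.1, fun i hi => (h.2 i).2 hi⟩

theorem exists_hasActiveSet [Finite ι] {x : E} (hx : x ∈ hPolyhedron n β) :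
    ∃ J, HasActiveSet n β x J := by
  classical
  have := Fintype.ofFinite ι
  exact ⟨Finset.univ.filter fun i => n i x = β i, hx, by simp⟩

theorem HasActiveSet.hFace_subset_iff {x : E} {J J' : Finset ι} (h : HasActiveSet n β x J) :
    hFace n β J ⊆ hFace n β J' ↔ J' ⊆ J :=
  ⟨fun hs i hi => (h.2 i).1 ((hs h.mem_hFace).2 i hi),
    fun hs _ hy => ⟨hy.1, fun i hi => hy.2 i (hs hi)⟩⟩

theorem convex_hPolyhedron : Convex ℝ (hPolyhedron n β) := by
  intro x hx y hy a b ha hb hab i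
  have h1 := mul_le_mul_of_nonneg_left (hx i) ha
  have h2 := mul_le_mul_of_nonneg_left (hy i) hb
  have h3 : a * β i + b * β i = β i := by rw [← add_mul, hab, one_mul]
  simp only [map_add, map_smul, smul_eq_mul]
  linarith

/-- One can move a little from a point of the polyhedron into every direction along which the tight
inequalities do not grow. -/
theorem exists_pos_add_smul_mem [Finite ι] {x v : E} (hx : x ∈ hPolyhedron n β)
    (hv : ∀ i, n i x = β i → n i v ≤ 0) : ∃ t : ℝ, 0 < t ∧ x + t • v ∈ hPolyhedron n β := by
  have key : ∀ i, ∀ᶠ t : ℝ in 𝓝[>] 0, n i (x + t • v) ≤ β i := by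
    intro i
    by_cases h : n i x = β i
    · filter_upwards [self_mem_nhdsWithin] with t ht
      have := mul_nonpos_of_nonneg_of_nonpos (le_of_lt (Set.mem_Ioi.1 ht)) (hv i h)
      simp only [map_add, map_smul, smul_eq_mul]
      linarith
    · have hc : Continuous fun t : ℝ => n i x + t * n i v := by fun_prop
      have h0 : n i x + 0 * n i v < β i := by
        rw [zero_mul, add_zero]; exact lt_of_le_of_ne (hx i) h
      filter_upwards [(hc.tendsto 0).eventually_lt_const h0 |>.filter_mono nhdsWithin_le_nhds]
        with t ht
      simp only [map_add, map_smul, smul_eq_mul]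
      exact ht.le
  obtain ⟨t, ht, ht0⟩ := ((eventually_all.2 key).and self_mem_nhdsWithin).exists
  exact ⟨t, ht0, ht⟩

/-- A polyhedron with a point satisfying all its inequalities strictly is full-dimensional. -/
theorem vectorSpan_hPolyhedron [Finite ι] {x : E} (hx : HasActiveSet n β x ∅) :
    vectorSpan ℝ (hPolyhedron n β) = ⊤ := by
  refine eq_top_iff.2 fun v _ => ?_
  obtain ⟨t, ht, hmem⟩ := exists_pos_add_smul_mem (v := v) hx.1
    (fun i hi => absurd ((hx.2 i).1 hi) (by simp))
  have := vsub_mem_vectorSpan ℝ hmem hx.1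
  rw [vsub_eq_sub, add_sub_cancel_left] at this
  exact (Submodule.smul_mem_iff _ ht.ne').1 this

/-- An extreme point is determined by its tight inequalities. -/
theorem eq_of_mem_extremePoints [Finite ι] {x y : E}
    (hx : x ∈ (hPolyhedron n β).extremePoints ℝ) (hy : y ∈ hPolyhedron n β)
    (h : ∀ i, n i x = β i → n i y = β i) : y = x := by
  obtain ⟨t, ht, hmem⟩ := exists_pos_add_smul_mem (v := x - y) hx.1
    (fun i hi => by rw [map_sub, hi, h i hi, sub_self])
  refine (mem_extremePoints.1 hx).2 y hy _ hmem ?_ |>.1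
  refine ⟨t / (1 + t), 1 / (1 + t), by positivity, by positivity, by field_simp; ring, ?_⟩
  have h1 : (1 + t) ≠ 0 := by positivity
  have : (t / (1 + t)) • y + (1 / (1 + t)) • (x + t • (x - y)) =
      ((1 / (1 + t)) * (1 + t)) • x := by rw [div_eq_mul_one_div t]; module
  rw [this, one_div_mul_cancel h1, one_smul]

theorem finite_extremePoints_hPolyhedron [Finite ι] :
    ((hPolyhedron n β).extremePoints ℝ).Finite := by
  classical
  have := Fintype.ofFinite ι
  refine Set.Finite.of_injOn (f := fun x => Finset.univ.filter fun i => n i x = β i)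
    (t := Set.univ) (fun _ _ => Set.mem_univ _) ?_ Set.finite_univ
  intro x hx y hy hxy
  refine (eq_of_mem_extremePoints hx hy.1 fun i hi => ?_).symm
  simpa [hi] using Finset.ext_iff.1 hxy i

/-- A positive combination of the inequalities in `J` attains its maximum exactly on `hFace J`. -/
theorem sum_smul_lt_of_notMem_hFace {J : Finset ι} {μ : ι → ℝ} (hμ : ∀ i ∈ J, 0 < μ i) {x : E}
    (hx : x ∈ hPolyhedron n β) (hxJ : x ∉ hFace n β J) :
    ∑ i ∈ J, μ i * n i x < ∑ i ∈ J, μ i * β i := by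
  have : ∃ i ∈ J, n i x ≠ β i := by
    by_contra! hcon
    exact hxJ ⟨hx, hcon⟩
  obtain ⟨i, hi, hne⟩ := this
  exact Finset.sum_lt_sum (fun k hk => mul_le_mul_of_nonneg_left (hx k) (hμ k hk).le)
    ⟨i, hi, mul_lt_mul_of_pos_left (lt_of_le_of_ne (hx i) hne) (hμ i hi)⟩

/-- The nonempty faces are the sets `hFace J`, where `J` runs through the sets of tight
inequalities of points: take a point of the face for which this set is smallest. -/
theorem exists_eq_hFace_of_isExposed [TopologicalSpace E] [Finite ι] {F : Set E}
    (hF : IsExposed ℝ (hPolyhedron n β) F) (hne : F.Nonempty) :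
    ∃ J, (∃ x, HasActiveSet n β x J) ∧ F = hFace n β J := by
  classical
  obtain ⟨l, hl⟩ := hF hne
  have hex : ∃ k, ∃ x ∈ F, ∃ J, HasActiveSet n β x J ∧ J.card = k := by
    obtain ⟨x, hx⟩ := hne
    obtain ⟨J, hJ⟩ := exists_hasActiveSet (hF.subset hx)
    exact ⟨_, x, hx, J, hJ, rfl⟩
  obtain ⟨x, hx, J, hJ, hcard⟩ := Nat.find_spec hex
  refine ⟨J, ⟨x, hJ⟩, Set.Subset.antisymm (fun y hy => ⟨hF.subset hy, fun i hi => ?_⟩) ?_⟩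
  · set z : E := (1 / 2 : ℝ) • x + (1 / 2 : ℝ) • y with hz
    have hzF : z ∈ F := (hF.convex convex_hPolyhedron) hx hy (by norm_num) (by norm_num)
      (by norm_num)
    obtain ⟨J', hJ'⟩ := exists_hasActiveSet (hF.subset hzF)
    have hact : ∀ k ∈ J', n k x = β k ∧ n k y = β k := by
      intro k hk
      have h1 := (hJ'.2 k).2 hk
      have h2 := hF.subset hx k
      have h3 := hF.subset hy k
      simp only [hz, map_add, map_smul, smul_eq_mul] at h1
      constructor <;> linarith
    have hsub : J' ⊆ J := fun k hk => (hJ.2 k).1 (hact k hk).1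
    have hmin := Nat.find_min' hex ⟨z, hzF, J', hJ', rfl⟩
    have : J' = J := Finset.eq_of_subset_of_card_le hsub (by omega)
    exact (hact i (this ▸ hi)).2
  · rintro y ⟨hy, hyJ⟩
    obtain ⟨t, ht, hmem⟩ := exists_pos_add_smul_mem (v := x - y) hJ.1
      (fun i hi => by rw [map_sub, hi, hyJ i ((hJ.2 i).1 hi), sub_self])
    rw [hl] at hx ⊢
    refine ⟨hy, fun z hz => (hx.2 z hz).trans ?_⟩
    have h1 := hx.2 _ hmem
    simp only [map_add, map_smul, map_sub, smul_eq_mul] at h1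
    nlinarith

variable [TopologicalSpace E] [IsTopologicalAddGroup E] [ContinuousSMul ℝ E] [T2Space E]

theorem convexHull_extremePoints_hPolyhedron [LocallyConvexSpace ℝ E] [Finite ι]
    (hc : IsCompact (hPolyhedron n β)) :
    convexHull ℝ ((hPolyhedron n β).extremePoints ℝ) = hPolyhedron n β := by
  have h := closure_convexHull_extremePoints hc convex_hPolyhedron
  rwa [(finite_extremePoints_hPolyhedron.isCompact_convexHull ℝ).isClosed.closure_eq] at h

theorem isPolytope_hPolyhedron [LocallyConvexSpace ℝ E] [Finite ι]
    (hc : IsCompact (hPolyhedron n β)) (hne : (hPolyhedron n β).Nonempty) :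
    IsPolytope (hPolyhedron n β) := by
  refine ⟨(finite_extremePoints_hPolyhedron (n := n) (β := β)).toFinset, ?_, ?_⟩
  · exact (Set.Finite.toFinset_nonempty _).2 (hc.extremePoints_nonempty hne)
  · rw [Set.Finite.coe_toFinset, convexHull_extremePoints_hPolyhedron hc]

variable [FiniteDimensional ℝ E]

theorem isClosed_hPolyhedron : IsClosed (hPolyhedron n β) := by
  have : hPolyhedron n β = ⋂ i, {x | n i x ≤ β i} := by ext; simp [hPolyhedron]
  rw [this]
  exact isClosed_iInter fun i =>
    isClosed_le (n i).continuous_of_finiteDimensional continuous_const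

theorem isExposed_of_forall_lt {P F : Set E} (l : E →ₗ[ℝ] ℝ) (c : ℝ) (hF : F ⊆ P)
    (h : ∀ x ∈ F, l x = c) (h' : ∀ x ∈ P, x ∉ F → l x < c) : IsExposed ℝ P F := by
  rintro ⟨z, hz⟩
  refine ⟨LinearMap.toContinuousLinearMap l, Set.Subset.antisymm (fun x hx => ⟨hF hx, ?_⟩) ?_⟩
  · intro y hy
    by_cases hyF : y ∈ F
    · simp [h x hx, h y hyF]
    · simpa [h x hx] using (h' y hy hyF).le
  · rintro x ⟨hx, hmax⟩
    by_contra hxF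
    have h1 := hmax z (hF hz)
    have h2 := h' x hx hxF
    have h3 := h z hz
    simp only [LinearMap.coe_toContinuousLinearMap'] at h1
    linarith

theorem isExposed_hFace (J : Finset ι) : IsExposed ℝ (hPolyhedron n β) (hFace n β J) := by
  refine isExposed_of_forall_lt (∑ i ∈ J, n i) (∑ i ∈ J, β i) (fun x hx => hx.1) ?_ ?_
  · intro x hx
    simpa using Finset.sum_congr rfl hx.2
  · intro x hx hxJ
    simpa using sum_smul_lt_of_notMem_hFace (μ := fun _ => 1) (by simp) hx hxJ

end HPolyhedron

/-! ### Dimensions along chains of faces, and isomorphisms of face posets -/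

section Chains

variable {ι E : Type*} [AddCommGroup E] [Module ℝ E] [TopologicalSpace E] [FiniteDimensional ℝ E]

theorem polyDim_lt_of_ssubset {X F G : Set E} (hF : IsExposed ℝ X F) (hne : F.Nonempty)
    (hFG : F ⊂ G) (hG : G ⊆ X) : polyDim F < polyDim G := by
  obtain ⟨l, hl⟩ := hF hne
  obtain ⟨x, hx⟩ := hne
  obtain ⟨y, hyG, hyF⟩ := Set.exists_of_ssubset hFG
  refine Submodule.finrank_lt_finrank_of_lt (lt_of_le_of_ne (vectorSpan_mono ℝ hFG.1) fun heq => ?_)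
  have hker : vectorSpan ℝ F ≤ LinearMap.ker (l : E →ₗ[ℝ] ℝ) := by
    refine Submodule.span_le.2 ?_
    rintro _ ⟨a, ha, b, hb, rfl⟩
    rw [hl] at ha hb
    have := ha.2 b hb.1
    have := hb.2 a ha.1
    simp only [vsub_eq_sub, SetLike.mem_coe, LinearMap.mem_ker, map_sub,
      ContinuousLinearMap.coe_coe]
    linarith
  have h1 : y - x ∈ LinearMap.ker (l : E →ₗ[ℝ] ℝ) :=
    hker (heq ▸ vsub_mem_vectorSpan ℝ hyG (hFG.1 hx))
  simp only [LinearMap.mem_ker, map_sub, ContinuousLinearMap.coe_coe] at h1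
  refine hyF ?_
  rw [hl] at hx ⊢
  exact ⟨hG hyG, fun z hz => (hx.2 z hz).trans (by linarith)⟩

/-- For faces indexed, with reversed inclusion, by the members of at least a given size of a
simplicial complex, the dimension drops at least by one whenever the index set grows by one
element. -/
theorem polyDim_add_card_le {𝒜 : Set (Finset ι)} (hdown : ∀ J J', J ⊆ J' → J' ∈ 𝒜 → J ∈ 𝒜)
    {X : Set E} {F : Finset ι → Set E} {k : ℕ}
    (hne : ∀ J ∈ 𝒜, k ≤ J.card → (F J).Nonempty)
    (hexp : ∀ J ∈ 𝒜, k ≤ J.card → IsExposed ℝ X (F J))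
    (hsub : ∀ J ∈ 𝒜, k ≤ J.card → ∀ J' ∈ 𝒜, k ≤ J'.card → (F J ⊆ F J' ↔ J' ⊆ J))
    {J J' : Finset ι} (hJ : J ⊆ J') (hJ' : J' ∈ 𝒜) (hk : k ≤ J.card) :
    polyDim (F J') + J'.card ≤ polyDim (F J) + J.card := by
  classical
  induction J' using Finset.strongInduction with
  | H J' ih =>
    by_cases h : J' ⊆ J
    · rw [Finset.Subset.antisymm h hJ]
    · obtain ⟨a, ha, haJ⟩ := Finset.not_subset.1 h
      have hJe : J ⊆ J'.erase a := Finset.subset_erase.2 ⟨hJ, haJ⟩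
      have hss : J'.erase a ⊂ J' := Finset.erase_ssubset ha
      have hA : J'.erase a ∈ 𝒜 := hdown _ _ hss.1 hJ'
      have h1 := ih _ hss hJe hA
      have hke : k ≤ (J'.erase a).card := hk.trans (Finset.card_le_card hJe)
      have hk' : k ≤ J'.card := hk.trans (Finset.card_le_card hJ)
      have hlt : polyDim (F J') < polyDim (F (J'.erase a)) := by
        refine polyDim_lt_of_ssubset (hexp _ hJ' hk') (hne _ hJ' hk') ⟨?_, ?_⟩
          (hexp _ hA hke).subset
        · exact (hsub _ hJ' hk' _ hA hke).2 hss.1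
        · exact fun hcon => hss.2 ((hsub _ hA hke _ hJ' hk').1 hcon)
      have := Finset.card_erase_add_one ha
      omega

end Chains

theorem nonempty_orderIso_of_surjective {γ α β : Type*} [PartialOrder α] [PartialOrder β]
    {f : γ → α} {g : γ → β} (hf : f.Surjective) (hg : g.Surjective)
    (h : ∀ a b, f a ≤ f b ↔ g a ≤ g b) : Nonempty (α ≃o β) := by
  have e1 : ∀ c, g (Function.surjInv hf (f c)) = g c := fun c => by
    have := Function.surjInv_eq hf (f c)
    exact le_antisymm ((h _ _).1 this.le) ((h _ _).1 this.ge)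
  have e2 : ∀ c, f (Function.surjInv hg (g c)) = f c := fun c => by
    have := Function.surjInv_eq hg (g c)
    exact le_antisymm ((h _ _).2 this.le) ((h _ _).2 this.ge)
  refine ⟨⟨⟨fun a => g (Function.surjInv hf a), fun b => f (Function.surjInv hg b), ?_, ?_⟩, ?_⟩⟩
  · intro a
    exact (e2 _).trans (Function.surjInv_eq hf a)
  · intro b
    exact (e1 _).trans (Function.surjInv_eq hg b)
  · intro a b
    simp only [Equiv.coe_fn_mk]
    rw [← h, Function.surjInv_eq hf, Function.surjInv_eq hf]

/-- Two posets of sets, both containing the empty set, are isomorphic if their nonempty members are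
indexed by the same type in such a way that inclusions correspond. -/
theorem nonempty_orderIso_of_families {α E E' : Type*} {p : Set E → Prop} {p' : Set E' → Prop}
    (hp : p ∅) (hp' : p' ∅) (F : α → Set E) (F' : α → Set E')
    (hF : ∀ a, p (F a)) (hF' : ∀ a, p' (F' a))
    (hne : ∀ a, (F a).Nonempty) (hne' : ∀ a, (F' a).Nonempty)
    (hsurj : ∀ S, p S → S.Nonempty → ∃ a, F a = S)
    (hsurj' : ∀ S, p' S → S.Nonempty → ∃ a, F' a = S)
    (hsub : ∀ a b, F a ⊆ F b ↔ F' a ⊆ F' b) :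
    Nonempty ({S : Set E // p S} ≃o {S : Set E' // p' S}) := by
  let f : Option α → {S : Set E // p S} := fun o => o.elim ⟨∅, hp⟩ fun a => ⟨F a, hF a⟩
  let g : Option α → {S : Set E' // p' S} := fun o => o.elim ⟨∅, hp'⟩ fun a => ⟨F' a, hF' a⟩
  have hf : f.Surjective := by
    rintro ⟨S, hS⟩
    rcases S.eq_empty_or_nonempty with rfl | hn
    · exact ⟨none, rfl⟩
    · obtain ⟨a, rfl⟩ := hsurj S hS hn
      exact ⟨some a, rfl⟩
  have hg : g.Surjective := by
    rintro ⟨S, hS⟩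
    rcases S.eq_empty_or_nonempty with rfl | hn
    · exact ⟨none, rfl⟩
    · obtain ⟨a, rfl⟩ := hsurj' S hS hn
      exact ⟨some a, rfl⟩
  refine nonempty_orderIso_of_surjective hf hg ?_
  rintro (_ | a) (_ | b)
  · exact ⟨fun _ => le_rfl, fun _ => le_rfl⟩
  · exact ⟨fun _ => Set.empty_subset _, fun _ => Set.empty_subset _⟩
  · exact ⟨fun h => absurd (Set.subset_empty_iff.1 h) (hne a).ne_empty,
      fun h => absurd (Set.subset_empty_iff.1 h) (hne' a).ne_empty⟩
  · exact hsub a b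

/-! ### Polygons given by vertices and edges -/

section Bounded

variable {ι E : Type*} [NormedAddCommGroup E] [NormedSpace ℝ E] [FiniteDimensional ℝ E]

/-- A polyhedron without recession directions is bounded. -/
theorem exists_norm_le_of_mem_hPolyhedron [Finite ι] {n : ι → E →ₗ[ℝ] ℝ}
    (h : ∀ y, (∀ i, n i y ≤ 0) → y = 0) (β : ι → ℝ) :
    ∃ R, ∀ x ∈ hPolyhedron n β, ‖x‖ ≤ R := by
  have := Fintype.ofFinite ι
  have : ProperSpace E := FiniteDimensional.proper ℝ E
  have hn : ∀ i, Continuous (n i) := fun i => (n i).continuous_of_finiteDimensional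
  rcases (Metric.sphere (0 : E) 1).eq_empty_or_nonempty with hS | hS
  · refine ⟨0, fun x _ => ?_⟩
    by_contra hx
    have hx' : ‖x‖ ≠ 0 := fun h0 => hx h0.le
    have : ‖x‖⁻¹ • x ∈ Metric.sphere (0 : E) 1 := by
      rw [mem_sphere_zero_iff_norm, norm_smul, norm_inv, norm_norm, inv_mul_cancel₀ hx']
    simp [hS] at this
  · have hf : Continuous fun y : E => ∑ i, max (n i y) 0 := by fun_prop
    obtain ⟨z, hz, hmin⟩ := (isCompact_sphere (0 : E) 1).exists_isMinOn hS hf.continuousOn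
    have hpos : 0 < ∑ i, max (n i z) 0 := by
      by_contra hcon
      have h0 : ∑ i, max (n i z) 0 = 0 :=
        le_antisymm (not_lt.1 hcon) (Finset.sum_nonneg fun i _ => le_max_right _ _)
      have h1 := (Finset.sum_eq_zero_iff_of_nonneg fun i _ => le_max_right _ _).1 h0
      have : z = 0 := h z fun i => (le_max_left _ _).trans (h1 i (Finset.mem_univ i)).le
      simp [this] at hz
    refine ⟨(∑ i, max (β i) 0) / ∑ i, max (n i z) 0, fun x hx => ?_⟩
    rw [le_div_iff₀ hpos]
    rcases eq_or_ne x 0 with rfl | hx0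
    · simpa using Finset.sum_nonneg fun i _ => le_max_right (β i) 0
    have hx' : ‖x‖ ≠ 0 := norm_ne_zero_iff.2 hx0
    have hmem : ‖x‖⁻¹ • x ∈ Metric.sphere (0 : E) 1 := by
      rw [mem_sphere_zero_iff_norm, norm_smul, norm_inv, norm_norm, inv_mul_cancel₀ hx']
    have h1 : ∑ i, max (n i z) 0 ≤ ∑ i, max (n i (‖x‖⁻¹ • x)) 0 := hmin hmem
    calc ‖x‖ * ∑ i, max (n i z) 0 ≤ ‖x‖ * ∑ i, max (n i (‖x‖⁻¹ • x)) 0 := by gcongr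
      _ = ∑ i, max (n i x) 0 := by
        rw [Finset.mul_sum]
        refine Finset.sum_congr rfl fun i _ => ?_
        rw [mul_max_of_nonneg _ _ (norm_nonneg x), mul_zero, map_smul, smul_eq_mul,
          mul_inv_cancel_left₀ hx']
      _ ≤ ∑ i, max (β i) 0 := Finset.sum_le_sum fun i _ => max_le_max_right _ (hx i)

theorem isCompact_hPolyhedron [Finite ι] {n : ι → E →ₗ[ℝ] ℝ} {β : ι → ℝ}
    {R : ℝ} (h : ∀ x ∈ hPolyhedron n β, ‖x‖ ≤ R) : IsCompact (hPolyhedron n β) := by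
  have : ProperSpace E := FiniteDimensional.proper ℝ E
  refine Metric.isCompact_of_isClosed_isBounded isClosed_hPolyhedron ?_
  exact isBounded_iff_forall_norm_le.2 ⟨R, h⟩

end Bounded

theorem fin_val_add_one {m : ℕ} [NeZero m] (hm : 2 ≤ m) (i : Fin m) :
    ((i + 1 : Fin m) : ℕ) = if (i : ℕ) + 1 = m then 0 else (i : ℕ) + 1 := by
  have : (1 : Fin m).val = 1 := by
    rw [Fin.val_one', Nat.mod_eq_of_lt (by omega)]
  rw [Fin.val_add, this]
  split_ifs with h
  · rw [h, Nat.mod_self]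
  · exact Nat.mod_eq_of_lt (by have := i.isLt; omega)

theorem fin_add_one_ne {m : ℕ} [NeZero m] (hm : 4 ≤ m) (i : Fin m) :
    i + 1 ≠ i ∧ i + 1 + 1 ≠ i ∧ i + 1 + 1 + 1 ≠ i := by
  have h1 := fin_val_add_one (by omega) i
  have h2 := fin_val_add_one (by omega) (i + 1)
  have h3 := fin_val_add_one (by omega) (i + 1 + 1)
  have := i.isLt
  simp only [ne_eq, Fin.ext_iff]
  split_ifs at h1 h2 h3 <;> omega

/-- The linear form given by a row of a matrix. -/
noncomputable def rowForm {ι κ : Type*} [Fintype κ] (A : Matrix ι κ ℝ) (i : ι) :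
    (κ → ℝ) →ₗ[ℝ] ℝ := LinearMap.proj i ∘ₗ A.mulVecLin

theorem rowForm_apply {ι κ : Type*} [Fintype κ] (A : Matrix ι κ ℝ) (i : ι) (x : κ → ℝ) :
    rowForm A i x = A.mulVec x i := rfl

theorem rowForm_fin_two {ι : Type*} (A : Matrix ι (Fin 2) ℝ) (i : ι) (x : Fin 2 → ℝ) :
    rowForm A i x = A i 0 * x 0 + A i 1 * x 1 := by
  simp [rowForm_apply, Matrix.mulVec, dotProduct, Fin.sum_univ_two]

/-- The inequalities `A x ≤ β` in the plane and the points `w` are the edges and vertices of a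
polygon, in cyclic order: the edges `k` and `k + 1` meet in the vertex `w k`, and all other
inequalities are strict there. -/
structure IsNGon {m : ℕ} [NeZero m] (A : Matrix (Fin m) (Fin 2) ℝ) (β : Fin m → ℝ)
    (w : Fin m → Fin 2 → ℝ) : Prop where
  le : ∀ i k, rowForm A i (w k) ≤ β i
  eq_iff : ∀ i k, rowForm A i (w k) = β i ↔ i = k ∨ i = k + 1

namespace IsNGon

open Filter Topology

variable {m : ℕ} [NeZero m] {A : Matrix (Fin m) (Fin 2) ℝ} {β : Fin m → ℝ}
  {w : Fin m → Fin 2 → ℝ}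

theorem lt (h : IsNGon A β w) {i k : Fin m} (h1 : i ≠ k) (h2 : i ≠ k + 1) :
    rowForm A i (w k) < β i :=
  lt_of_le_of_ne (h.le i k) fun he => ((h.eq_iff i k).1 he).elim h1 h2

theorem det_ne_zero (h : IsNGon A β w) (hm : 4 ≤ m) (k : Fin m) :
    A k 0 * A (k + 1) 1 - A k 1 * A (k + 1) 0 ≠ 0 := by
  obtain ⟨j, rfl⟩ : ∃ j, k = j + 1 := ⟨k - 1, (sub_add_cancel k 1).symm⟩
  have n1 := fin_add_one_ne hm j
  have n2 := fin_add_one_ne hm (j + 1)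
  have e1 := (h.eq_iff (j + 1) j).2 (Or.inr rfl)
  have e2 := (h.eq_iff (j + 1) (j + 1)).2 (Or.inl rfl)
  have e3 := (h.eq_iff (j + 1 + 1) (j + 1)).2 (Or.inr rfl)
  have e4 := h.lt (i := j + 1 + 1) (k := j) n1.2.1 n2.1
  have e5 := h.lt (i := j + 1) (k := j + 1 + 1) n2.1.symm n2.2.1.symm
  rw [rowForm_fin_two] at e1 e2 e3 e4 e5
  intro hdet
  set a := A (j + 1) 0
  set b := A (j + 1) 1
  set c := A (j + 1 + 1) 0
  set d := A (j + 1 + 1) 1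
  have hpos : 0 < c * (w (j + 1) 0 - w j 0) + d * (w (j + 1) 1 - w j 1) := by linarith
  have hzero : a * (w (j + 1) 0 - w j 0) + b * (w (j + 1) 1 - w j 1) = 0 := by linarith
  have ha : a = 0 := by
    have : a * (c * (w (j + 1) 0 - w j 0) + d * (w (j + 1) 1 - w j 1)) = 0 := by
      linear_combination c * hzero + (w (j + 1) 1 - w j 1) * hdet
    exact (mul_eq_zero.1 this).resolve_right hpos.ne'
  have hb : b = 0 := by
    have : b * (c * (w (j + 1) 0 - w j 0) + d * (w (j + 1) 1 - w j 1)) = 0 := by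
      linear_combination d * hzero - (w (j + 1) 0 - w j 0) * hdet
    exact (mul_eq_zero.1 this).resolve_right hpos.ne'
  rw [ha, hb] at e1 e5
  linarith

theorem eq_of_rowForm_eq (h : IsNGon A β w) (hm : 4 ≤ m) (k : Fin m) {x y : Fin 2 → ℝ}
    (h1 : rowForm A k x = rowForm A k y) (h2 : rowForm A (k + 1) x = rowForm A (k + 1) y) :
    x = y := by
  have hd := h.det_ne_zero hm k
  rw [rowForm_fin_two, rowForm_fin_two] at h1 h2
  have e0 : (A k 0 * A (k + 1) 1 - A k 1 * A (k + 1) 0) * (x 0 - y 0) = 0 := by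
    linear_combination A (k + 1) 1 * h1 - A k 1 * h2
  have e1 : (A k 0 * A (k + 1) 1 - A k 1 * A (k + 1) 0) * (x 1 - y 1) = 0 := by
    linear_combination A k 0 * h2 - A (k + 1) 0 * h1
  ext i
  fin_cases i
  · exact sub_eq_zero.1 ((mul_eq_zero.1 e0).resolve_left hd)
  · exact sub_eq_zero.1 ((mul_eq_zero.1 e1).resolve_left hd)

/-- The points on the edge `j + 1` lie between the vertices `w j` and `w (j + 1)`. -/
theorem exists_eq_on_edge (h : IsNGon A β w) (hm : 4 ≤ m) {x : Fin 2 → ℝ}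
    (hx : x ∈ hPolyhedron (rowForm A) β) {j : Fin m} (hj : rowForm A (j + 1) x = β (j + 1)) :
    ∃ t : ℝ, 0 ≤ t ∧ t ≤ 1 ∧ x = w j + t • (w (j + 1) - w j) := by
  have n1 := fin_add_one_ne hm j
  have n2 := fin_add_one_ne hm (j + 1)
  have e1 := (h.eq_iff (j + 1) j).2 (Or.inr rfl)
  have e2 := (h.eq_iff (j + 1) (j + 1)).2 (Or.inl rfl)
  have e3 := (h.eq_iff (j + 1 + 1) (j + 1)).2 (Or.inr rfl)
  have e4 := h.lt (i := j + 1 + 1) (k := j) n1.2.1 n2.1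
  have e5 := (h.eq_iff j j).2 (Or.inl rfl)
  have e6 := h.lt (i := j) (k := j + 1) n1.1.symm n1.2.1.symm
  have hD : 0 < β (j + 1 + 1) - rowForm A (j + 1 + 1) (w j) := by linarith
  set t := (rowForm A (j + 1 + 1) x - rowForm A (j + 1 + 1) (w j)) /
    (β (j + 1 + 1) - rowForm A (j + 1 + 1) (w j)) with ht
  have htD := div_mul_cancel₀ (rowForm A (j + 1 + 1) x - rowForm A (j + 1 + 1) (w j)) hD.ne'
  rw [← ht] at htD
  have hxt : x = w j + t • (w (j + 1) - w j) := by
    refine h.eq_of_rowForm_eq hm (j + 1) ?_ ?_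
    · simp only [map_add, map_smul, map_sub, smul_eq_mul, e1, e2, hj]
      ring
    · simp only [map_add, map_smul, map_sub, smul_eq_mul, e3]
      linarith
  refine ⟨t, ?_, (div_le_one hD).2 (sub_le_sub_right (hx _) _), hxt⟩
  have h1 := hx j
  rw [hxt] at h1
  simp only [map_add, map_smul, map_sub, smul_eq_mul, e5] at h1
  nlinarith

/-- At most two inequalities of a polygon are tight at any of its points, and they are adjacent. -/
theorem exists_active_subset (h : IsNGon A β w) (hm : 4 ≤ m) {x : Fin 2 → ℝ}
    (hx : x ∈ hPolyhedron (rowForm A) β) :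
    ∃ k, ∀ i, rowForm A i x = β i → i = k ∨ i = k + 1 := by
  by_cases hact : ∃ i, rowForm A i x = β i
  · obtain ⟨i, hi⟩ := hact
    obtain ⟨j, rfl⟩ : ∃ j, i = j + 1 := ⟨i - 1, (sub_add_cancel i 1).symm⟩
    obtain ⟨t, ht0, ht1, hxt⟩ := h.exists_eq_on_edge hm hx hi
    rcases ht0.eq_or_lt with rfl | ht0
    · exact ⟨j, fun i' hi' => (h.eq_iff i' j).1 (by simpa [hxt] using hi')⟩
    · refine ⟨j + 1, fun i' hi' => (h.eq_iff i' (j + 1)).1 (le_antisymm (h.le _ _) ?_)⟩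
      rw [hxt] at hi'
      simp only [map_add, map_smul, map_sub, smul_eq_mul] at hi'
      have h1 := h.le i' j
      nlinarith
  · exact ⟨0, fun i hi => absurd ⟨i, hi⟩ hact⟩

/-- Every set of at most two adjacent edges is the set of tight inequalities of a point. -/
theorem exists_hasActiveSet (h : IsNGon A β w) (hm : 4 ≤ m) {J : Finset (Fin m)} {k : Fin m}
    (hJ : ∀ i ∈ J, i = k ∨ i = k + 1) : ∃ x, HasActiveSet (rowForm A) β x J := by
  have mid : ∀ a b, (∀ i, ((i = a ∨ i = a + 1) ∧ (i = b ∨ i = b + 1)) ↔ i ∈ J) →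
      ∃ x, HasActiveSet (rowForm A) β x J := by
    intro a b hab
    have hval : ∀ i, rowForm A i ((1 / 2 : ℝ) • (w a + w b)) =
        1 / 2 * (rowForm A i (w a) + rowForm A i (w b)) := by simp [mul_add]
    refine ⟨(1 / 2 : ℝ) • (w a + w b), fun i => ?_, fun i => ?_⟩
    · have h1 := h.le i a
      have h2 := h.le i b
      rw [hval]
      linarith
    · have h1 := h.le i a
      have h2 := h.le i b
      rw [hval, ← hab, ← h.eq_iff, ← h.eq_iff]
      constructor
      · intro h3
        constructor <;> linarith
      · rintro ⟨h3, h4⟩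
        linarith
  obtain ⟨j, rfl⟩ : ∃ j, k = j + 1 := ⟨k - 1, (sub_add_cancel k 1).symm⟩
  have n1 := fin_add_one_ne hm j
  have n2 := fin_add_one_ne hm (j + 1)
  have n3 := fin_add_one_ne hm (j + 1 + 1)
  by_cases h1 : j + 1 ∈ J <;> by_cases h2 : j + 1 + 1 ∈ J
  · exact mid (j + 1) (j + 1) (by grind)
  · exact mid j (j + 1) (by grind)
  · exact mid (j + 1) (j + 1 + 1) (by grind)
  · exact mid (j + 1) (j + 1 + 1 + 1) (by grind)

/-- The combinatorics of a polygon does not change under small changes of the right hand sides. -/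
theorem exists_perturbation (h : IsNGon A β w) (hm : 4 ≤ m) :
    ∃ η > 0, ∀ β' : Fin m → ℝ, (∀ i, |β' i - β i| ≤ η) → ∃ w', IsNGon A β' w' := by
  -- the vertices are given by Cramer's rule
  let D : Fin m → ℝ := fun k => A k 0 * A (k + 1) 1 - A k 1 * A (k + 1) 0
  let W : (Fin m → ℝ) → Fin m → Fin 2 → ℝ := fun β' k =>
    ![(β' k * A (k + 1) 1 - A k 1 * β' (k + 1)) / D k,
      (A k 0 * β' (k + 1) - A (k + 1) 0 * β' k) / D k]
  have hD : ∀ k, D k ≠ 0 := h.det_ne_zero hm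
  have hW1 : ∀ β' k, rowForm A k (W β' k) = β' k := by
    intro β' k
    have := hD k
    simp only [rowForm_fin_two, W, Matrix.cons_val_zero, Matrix.cons_val_one]
    field_simp
    simp only [D]
    ring
  have hW2 : ∀ β' k, rowForm A (k + 1) (W β' k) = β' (k + 1) := by
    intro β' k
    have := hD k
    simp only [rowForm_fin_two, W, Matrix.cons_val_zero, Matrix.cons_val_one]
    field_simp
    simp only [D]
    ring
  have hWβ : ∀ k, W β k = w k := fun k => by
    refine h.eq_of_rowForm_eq hm k ?_ ?_
    · rw [hW1, (h.eq_iff k k).2 (Or.inl rfl)]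
    · rw [hW2, (h.eq_iff (k + 1) k).2 (Or.inr rfl)]
  have hev : ∀ᶠ β' in 𝓝 β, ∀ i k, i ≠ k → i ≠ k + 1 → rowForm A i (W β' k) < β' i := by
    refine eventually_all.2 fun i => eventually_all.2 fun k => ?_
    by_cases hi : i = k ∨ i = k + 1
    · exact Eventually.of_forall fun β' h1 h2 => (hi.elim h1 h2).elim
    · have hlt : rowForm A i (W β k) < β i := by
        rw [hWβ]
        exact h.lt (fun e => hi (Or.inl e)) fun e => hi (Or.inr e)
      have hc : Continuous fun β' => rowForm A i (W β' k) := by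
        simp only [rowForm_fin_two, W, Matrix.cons_val_zero, Matrix.cons_val_one]
        fun_prop
      filter_upwards [hc.continuousAt.eventually_lt (continuous_apply i).continuousAt hlt]
        with β' hβ' _ _
      exact hβ'
  obtain ⟨η, hη, hball⟩ := Metric.nhds_basis_closedBall.eventually_iff.1 hev
  refine ⟨η, hη, fun β' hβ' => ⟨W β', ?_⟩⟩
  have hlt := hball (x := β') ((dist_pi_le_iff hη.le).2 hβ')
  refine ⟨fun i k => ?_, fun i k => ⟨fun he => ?_, ?_⟩⟩
  · by_cases h1 : i = k
    · subst h1; exact (hW1 β' i).le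
    · by_cases h2 : i = k + 1
      · subst h2; exact (hW2 β' k).le
      · exact (hlt i k h1 h2).le
  · by_contra hcon
    push Not at hcon
    exact (hlt i k hcon.1 hcon.2).ne he
  · rintro (rfl | rfl)
    · exact hW1 β' i
    · exact hW2 β' k

/-- A positive multiple of an inequality describes the same edge. -/
theorem scale (h : IsNGon A β w) {s : Fin m → ℝ} (hs : ∀ i, 0 < s i)
    {A' : Matrix (Fin m) (Fin 2) ℝ} {β' : Fin m → ℝ} (hA : ∀ i j, A' i j = s i * A i j)
    (hβ : ∀ i, β' i = s i * β i) : IsNGon A' β' w := by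
  have hval : ∀ i x, rowForm A' i x = s i * rowForm A i x := fun i x => by
    rw [rowForm_fin_two, rowForm_fin_two, hA, hA]
    ring
  refine ⟨fun i k => ?_, fun i k => ?_⟩
  · rw [hval, hβ]
    exact mul_le_mul_of_nonneg_left (h.le i k) (hs i).le
  · rw [hval, hβ, mul_right_inj' (hs i).ne', h.eq_iff]

theorem extremePoints_eq (h : IsNGon A β w) (hm : 4 ≤ m) :
    (hPolyhedron (rowForm A) β).extremePoints ℝ = Set.range w := by
  apply Set.Subset.antisymm
  · intro x hx
    obtain ⟨k, hk⟩ := h.exists_active_subset hm hx.1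
    exact ⟨k, eq_of_mem_extremePoints hx (fun i => h.le i k)
      fun i hi => (h.eq_iff i k).2 (hk i hi)⟩
  · rintro _ ⟨k, rfl⟩
    have : hFace (rowForm A) β {k, k + 1} = {w k} := by
      refine Set.eq_singleton_iff_unique_mem.2 ⟨⟨fun i => h.le i k, ?_⟩, ?_⟩
      · intro i hi
        exact (h.eq_iff i k).2 (by simpa using hi)
      · rintro y ⟨-, hy⟩
        refine h.eq_of_rowForm_eq hm k ?_ ?_
        · rw [hy k (by simp), (h.eq_iff k k).2 (Or.inl rfl)]
        · rw [hy (k + 1) (by simp), (h.eq_iff (k + 1) k).2 (Or.inr rfl)]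
    rw [← isExtreme_singleton, ← this]
    exact (isExposed_hFace _).isExtreme

theorem injective (h : IsNGon A β w) (hm : 4 ≤ m) : w.Injective := by
  intro j k hjk
  have h1 := (h.eq_iff j j).2 (Or.inl rfl)
  have h2 := (h.eq_iff (j + 1) j).2 (Or.inr rfl)
  rw [hjk, h.eq_iff] at h1 h2
  have n1 := fin_add_one_ne hm k
  grind

/-- The inequalities of a polygon without recession directions define a convex `m`-gon. -/
theorem isPolygon (h : IsNGon A β w) (hm : 4 ≤ m)
    (hrec : ∀ y, (∀ i, rowForm A i y ≤ 0) → y = 0) :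
    IsPolygon m (hPolyhedron (rowForm A) β) := by
  obtain ⟨R, hR⟩ := exists_norm_le_of_mem_hPolyhedron hrec β
  refine ⟨isPolytope_hPolyhedron (isCompact_hPolyhedron hR) ⟨w 0, fun i => h.le i 0⟩, ?_, ?_⟩
  · obtain ⟨x, hx⟩ := h.exists_hasActiveSet hm (J := ∅) (k := 0) (by simp)
    rw [polyDim, vectorSpan_hPolyhedron hx]
    simp
  · rw [h.extremePoints_eq hm, ← Set.image_univ, Set.ncard_image_of_injective _ (h.injective hm)]
    simp

end IsNGon

/-! ### The special polygon and the regular polygon -/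

section Special

/-- The slopes of the special polygon: they decrease from `1` at `i = 1` to `-1` at `i = m - 1`. -/
noncomputable def slope (m i : ℕ) : ℝ := ((m : ℝ) - 2 * i) / ((m : ℝ) - 2)

/-- Right hand sides for the special polygon. In the coordinates `x₀` and `u = ε x₁`, the lines
`x₀ + t u = 1 + t²` are tangent to the parabola `x₀ = 1 - u² / 4`, hence each of them contributes an
edge, and the line `x₀ = -1` cuts off a bounded polygon. -/
noncomputable def specialRhs (m : ℕ) (i : Fin m) : ℝ :=
  if (i : ℕ) = 0 then 1 else 1 + slope m i ^ 2

theorem specialRhs_pos {m : ℕ} (i : Fin m) : 0 < specialRhs m i := by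
  unfold specialRhs
  split_ifs <;> positivity

theorem slope_one {m : ℕ} (hm : 4 ≤ m) : slope m 1 = 1 := by
  have : (4 : ℝ) ≤ m := by exact_mod_cast hm
  have h2 : (m : ℝ) - 2 ≠ 0 := by linarith
  simp [slope, div_self h2]

theorem slope_last {m : ℕ} (hm : 4 ≤ m) : slope m (m - 1) = -1 := by
  have : (4 : ℝ) ≤ m := by exact_mod_cast hm
  have h2 : (m : ℝ) - 2 ≠ 0 := by linarith
  rw [slope, Nat.cast_sub (by omega)]
  field_simp
  push_cast
  ring

theorem slope_le_iff {m : ℕ} (hm : 4 ≤ m) {i k : ℕ} : slope m i ≤ slope m k ↔ k ≤ i := by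
  have h4 : (4 : ℝ) ≤ m := by exact_mod_cast hm
  have h2 : (0 : ℝ) < m - 2 := by linarith
  rw [slope, slope, div_le_div_iff_of_pos_right h2, ← Nat.cast_le (α := ℝ)]
  constructor <;> intro h <;> linarith

theorem slope_lt_iff {m : ℕ} (hm : 4 ≤ m) {i k : ℕ} : slope m i < slope m k ↔ k < i := by
  rw [← not_le, slope_le_iff hm, not_le]

theorem slope_eq_iff {m : ℕ} (hm : 4 ≤ m) {i k : ℕ} : slope m i = slope m k ↔ i = k := by
  rw [le_antisymm_iff, slope_le_iff hm, slope_le_iff hm]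
  omega

/-- The vertices of the special polygon. -/
noncomputable def specialVertex (m : ℕ) (ε : ℝ) (k : Fin m) : Fin 2 → ℝ :=
  if (k : ℕ) = 0 then ![-1, 3 / ε]
  else if (k : ℕ) + 1 = m then ![-1, -3 / ε]
  else ![1 - slope m k * slope m (k + 1), (slope m k + slope m (k + 1)) / ε]

/-- The normals of the special polygon before the even-indexed ones are scaled. -/
noncomputable def unscaledMatrix (m : ℕ) (ε : ℝ) : Matrix (Fin m) (Fin 2) ℝ := fun i =>
  if (i : ℕ) = 0 then ![-1, 0] else ![1, ε * slope m i]

/-- At each vertex, the slack of an inequality is a product of two linear factors in its slope, with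
zeros at the two edges that meet there. -/
theorem isNGon_unscaled {m : ℕ} [NeZero m] (hm : 4 ≤ m) {ε : ℝ} (hε : 0 < ε) :
    IsNGon (unscaledMatrix m ε) (specialRhs m) (specialVertex m ε) := by
  have key : ∀ i k : Fin m,
      0 ≤ specialRhs m i - rowForm (unscaledMatrix m ε) i (specialVertex m ε k) ∧
      (specialRhs m i - rowForm (unscaledMatrix m ε) i (specialVertex m ε k) = 0 ↔
        i = k ∨ i = k + 1) := by
    intro i k
    have hk1 := fin_val_add_one (by omega) k
    have hi := i.isLt
    have hk := k.isLt
    have hε' := hε.ne'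
    simp only [rowForm_fin_two, specialRhs, unscaledMatrix, specialVertex, Fin.ext_iff]
    rw [hk1]
    have t1 : 0 < (i : ℕ) → slope m i ≤ 1 := fun h => by
      rw [← slope_one hm, slope_le_iff hm]; exact h
    have t2 : -1 ≤ slope m i := by rw [← slope_last hm, slope_le_iff hm]; omega
    have t3 : slope m i = 1 ↔ (i : ℕ) = 1 := by rw [← slope_one hm, slope_eq_iff hm]
    have t4 : slope m i = -1 ↔ (i : ℕ) = m - 1 := by rw [← slope_last hm, slope_eq_iff hm]
    by_cases hk0 : (k : ℕ) = 0
    · have hkm : (k : ℕ) + 1 ≠ m := by omega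
      by_cases hi0 : (i : ℕ) = 0
      · simp [hk0, hi0]
      · have t1 := t1 (by omega)
        have e : 1 + slope m i ^ 2 - (1 * -1 + ε * slope m i * (3 / ε)) =
            (1 - slope m i) * (2 - slope m i) := by field_simp; ring
        simp only [hk0, hi0, if_true, if_false, Matrix.cons_val_zero, Matrix.cons_val_one, e]
        refine ⟨mul_nonneg (by linarith) (by linarith), ?_⟩
        rw [mul_eq_zero, or_iff_left (by linarith : 2 - slope m i ≠ 0), sub_eq_zero, eq_comm, t3]
        rw [false_or, if_neg (by omega)]
    · by_cases hkm : (k : ℕ) + 1 = m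
      · by_cases hi0 : (i : ℕ) = 0
        · simp [hk0, hi0, hkm]
        · have t1 := t1 (by omega)
          have e : 1 + slope m i ^ 2 - (1 * -1 + ε * slope m i * (-3 / ε)) =
              (slope m i + 1) * (2 + slope m i) := by field_simp; ring
          simp only [hk0, hi0, hkm, if_true, if_false, Matrix.cons_val_zero, Matrix.cons_val_one, e]
          refine ⟨mul_nonneg (by linarith) (by linarith), ?_⟩
          rw [mul_eq_zero, or_iff_left (by linarith : 2 + slope m i ≠ 0), ← eq_neg_iff_add_eq_zero,
            t4, or_false]
          omega
      · by_cases hi0 : (i : ℕ) = 0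
        · have a1 : slope m k ≤ 1 := by rw [← slope_one hm, slope_le_iff hm]; omega
          have a2 : slope m (k + 1) < 1 := by rw [← slope_one hm, slope_lt_iff hm]; omega
          have a3 : -1 < slope m k := by rw [← slope_last hm, slope_lt_iff hm]; omega
          have a4 : -1 ≤ slope m (k + 1) := by rw [← slope_last hm, slope_le_iff hm]; omega
          have e : 0 < 1 - (-1 * (1 - slope m k * slope m (k + 1)) +
              0 * ((slope m k + slope m (k + 1)) / ε)) := by nlinarith
          simp only [hk0, hi0, hkm, if_true, if_false, Matrix.cons_val_zero, Matrix.cons_val_one]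
          refine ⟨e.le, fun h => absurd h e.ne', ?_⟩
          omega
        · have e : 1 + slope m i ^ 2 - (1 * (1 - slope m k * slope m (k + 1)) +
              ε * slope m i * ((slope m k + slope m (k + 1)) / ε)) =
              (slope m k - slope m i) * (slope m (k + 1) - slope m i) := by field_simp; ring
          simp only [hk0, hi0, hkm, if_false, Matrix.cons_val_zero, Matrix.cons_val_one, e]
          constructor
          · rcases le_or_gt (i : ℕ) k with h | h
            · exact mul_nonneg_of_nonpos_of_nonpos (sub_nonpos.2 ((slope_le_iff hm).2 h))
                (sub_nonpos.2 ((slope_le_iff hm).2 (by omega)))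
            · exact mul_nonneg (sub_nonneg.2 ((slope_le_iff hm).2 h.le))
                (sub_nonneg.2 ((slope_le_iff hm).2 h))
          · rw [mul_eq_zero, sub_eq_zero, sub_eq_zero, slope_eq_iff hm, slope_eq_iff hm]
            omega
  exact ⟨fun i k => sub_nonneg.1 (key i k).1,
    fun i k => by rw [← (key i k).2, sub_eq_zero, eq_comm]⟩

theorem scale_pos {m : ℕ} {ε : ℝ} (hε : 0 < ε) (i : Fin m) : 0 < scale ε i := by
  unfold scale
  split_ifs
  · exact hε
  · exact one_pos

theorem isNGon_special {m : ℕ} [NeZero m] (hm : 4 ≤ m) {ε : ℝ} (hε : 0 < ε) :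
    IsNGon (polygonMatrix m ε) (fun i => scale ε i * specialRhs m i) (specialVertex m ε) := by
  refine (isNGon_unscaled hm hε).scale (scale_pos hε) (fun i j => ?_) fun i => rfl
  simp only [polygonMatrix, unscaledMatrix, slope, Pi.smul_apply, smul_eq_mul]

theorem special_recession {m : ℕ} [NeZero m] (hm : 4 ≤ m) {ε : ℝ} (hε : 0 < ε) (y : Fin 2 → ℝ)
    (hy : ∀ i, rowForm (polygonMatrix m ε) i y ≤ 0) : y = 0 := by
  have hval : ∀ i, rowForm (polygonMatrix m ε) i y =
      scale ε i * rowForm (unscaledMatrix m ε) i y := by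
    intro i
    rw [rowForm_fin_two, rowForm_fin_two]
    simp only [polygonMatrix, unscaledMatrix, slope, Pi.smul_apply, smul_eq_mul]
    ring
  have hy' : ∀ i, rowForm (unscaledMatrix m ε) i y ≤ 0 := fun i => by
    have := hy i
    rw [hval] at this
    exact nonpos_of_mul_nonpos_right this (scale_pos hε i)
  have h0 := hy' ⟨0, by omega⟩
  have h1 := hy' ⟨1, by omega⟩
  have h2 := hy' ⟨m - 1, by omega⟩
  have hm1 : m - 1 ≠ 0 := by omega
  simp only [rowForm_fin_two, unscaledMatrix, hm1, if_true, if_false, one_ne_zero, slope_one hm,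
    slope_last hm, Matrix.cons_val_zero, Matrix.cons_val_one] at h0 h1 h2
  have e0 : y 0 = 0 := by linarith
  have e1 : ε * y 1 = 0 := by linarith
  ext i
  fin_cases i
  · exact e0
  · exact (mul_eq_zero.1 e1).resolve_left hε.ne'

end Special

section Regular

open Real

/-- The outer normals of the edges of the regular polygon. -/
noncomputable def regularMatrix (m : ℕ) : Matrix (Fin m) (Fin 2) ℝ := fun i =>
  ![cos ((2 * (i : ℝ) - 1) * π / m), sin ((2 * (i : ℝ) - 1) * π / m)]

theorem cos_odd_mul_pi_div {m : ℕ} (hm : 4 ≤ m) {q : ℤ} (hodd : Odd q) (hq : |q| ≤ 2 * m - 1) :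
    cos (q * π / m) ≤ cos (π / m) ∧
      (cos (q * π / m) = cos (π / m) ↔ |q| = 1 ∨ |q| = 2 * m - 1) := by
  have hm0 : (0 : ℝ) < m := by exact_mod_cast (by omega : 0 < m)
  -- replace `q` by an odd number `p` with `0 < p ≤ m` and the same cosine
  obtain ⟨p, hp0, hpm, hcos, hp1⟩ : ∃ p : ℤ, 0 < p ∧ p ≤ m ∧ cos (q * π / m) = cos (p * π / m) ∧
      (p = 1 ↔ |q| = 1 ∨ |q| = 2 * m - 1) := by
    obtain ⟨s, hs⟩ := hodd
    have habs : cos (q * π / m) = cos ((|q| : ℤ) * π / m) := by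
      rcases abs_choice q with h | h <;> rw [h]
      rw [← cos_neg]
      congr 1
      push_cast
      ring
    rcases le_or_gt |q| m with h | h
    · exact ⟨|q|, by grind, h, habs, by grind⟩
    · refine ⟨2 * m - |q|, by grind, by grind, ?_, by grind⟩
      rw [habs, ← cos_neg, ← cos_add_two_pi]
      congr 1
      push_cast
      field_simp
      ring
  have hp0' : (1 : ℝ) ≤ p := by exact_mod_cast hp0
  have hpm' : (p : ℝ) ≤ m := by exact_mod_cast hpm
  have hmem : (p : ℝ) * π / m ∈ Set.Icc 0 π := by
    constructor
    · positivity
    · rw [div_le_iff₀ hm0, mul_comm]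
      gcongr
  have hmem1 : π / m ∈ Set.Icc 0 π := by
    refine ⟨by positivity, div_le_self pi_pos.le ?_⟩
    exact_mod_cast (by omega : 1 ≤ m)
  rw [hcos, ← hp1, injOn_cos.eq_iff hmem hmem1]
  constructor
  · apply strictAntiOn_cos.antitoneOn hmem1 hmem
    gcongr
    exact le_mul_of_one_le_left pi_pos.le hp0'
  · rw [div_left_inj' hm0.ne', mul_eq_right₀ pi_ne_zero]
    exact_mod_cast Iff.rfl

theorem isNGon_regular {m : ℕ} [NeZero m] (hm : 4 ≤ m) :
    IsNGon (regularMatrix m) (fun _ => cos (π / m)) (fun k : Fin m =>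
      ![cos (2 * π * (k : ℝ) / m), sin (2 * π * (k : ℝ) / m)]) := by
  have hm0 : (m : ℝ) ≠ 0 := by exact_mod_cast (by omega : m ≠ 0)
  have key : ∀ i k : Fin m, rowForm (regularMatrix m) i
      ![cos (2 * π * (k : ℝ) / m), sin (2 * π * (k : ℝ) / m)] =
      cos (((2 * ((k : ℕ) - (i : ℕ) : ℤ) + 1 : ℤ) : ℝ) * π / m) := by
    intro i k
    rw [rowForm_fin_two]
    simp only [regularMatrix, Matrix.cons_val_zero, Matrix.cons_val_one]
    rw [mul_comm (cos _), mul_comm (sin _), ← cos_sub]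
    congr 1
    push_cast
    field_simp
    ring
  have hfin : ∀ i k : Fin m, |(2 * ((k : ℕ) - (i : ℕ) : ℤ) + 1 : ℤ)| ≤ 2 * m - 1 := by
    intro i k
    have := i.isLt
    have := k.isLt
    rw [abs_le]
    constructor <;> omega
  refine ⟨fun i k => ?_, fun i k => ?_⟩
  · rw [key]
    exact (cos_odd_mul_pi_div hm (odd_two_mul_add_one _) (hfin i k)).1
  · rw [key, (cos_odd_mul_pi_div hm (odd_two_mul_add_one _) (hfin i k)).2]
    have := i.isLt
    have := k.isLt
    rw [Fin.ext_iff, Fin.ext_iff, fin_val_add_one (by omega)]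
    rcases abs_choice (2 * ((k : ℕ) - (i : ℕ) : ℤ) + 1) with h | h
    · have := abs_nonneg (2 * ((k : ℕ) - (i : ℕ) : ℤ) + 1)
      rw [h] at this ⊢
      split_ifs <;> omega
    · have := abs_nonneg (2 * ((k : ℕ) - (i : ℕ) : ℤ) + 1)
      rw [h] at this ⊢
      split_ifs <;> omega

theorem regular_recession {m : ℕ} [NeZero m] (hm : 4 ≤ m) (hev : Even m) (y : Fin 2 → ℝ)
    (hy : ∀ i, rowForm (regularMatrix m) i y ≤ 0) : y = 0 := by
  obtain ⟨p, rfl⟩ := hev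
  have hp : (0 : ℝ) < p := by exact_mod_cast (by omega : 0 < p)
  set θ := π / (p + p : ℕ) with hθ
  have hmul : (p + p : ℕ) * θ = π := by rw [hθ]; push_cast; field_simp
  have hθ0 : 0 < θ := by positivity
  have hθ1 : θ < π / 2 := by
    rw [hθ]
    refine div_lt_div_of_pos_left pi_pos two_pos ?_
    exact_mod_cast (by omega : 2 < p + p)
  have hrow : ∀ i : Fin (p + p), rowForm (regularMatrix (p + p)) i y =
      cos ((2 * (i : ℝ) - 1) * θ) * y 0 + sin ((2 * (i : ℝ) - 1) * θ) * y 1 := by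
    intro i
    rw [rowForm_fin_two]
    simp only [regularMatrix, Matrix.cons_val_zero, Matrix.cons_val_one, mul_div_assoc, hθ]
  have h0 := hy ⟨0, by omega⟩
  have h1 := hy ⟨1, by omega⟩
  have h2 := hy ⟨p, by omega⟩
  have h3 := hy ⟨p + 1, by omega⟩
  rw [hrow] at h0 h1 h2 h3
  have e0 : (2 * ((0 : ℕ) : ℝ) - 1) * θ = -θ := by push_cast; ring
  have e1 : (2 * ((1 : ℕ) : ℝ) - 1) * θ = θ := by push_cast; ring
  have e2 : (2 * ((p : ℕ) : ℝ) - 1) * θ = π - θ := by rw [← hmul]; push_cast; ring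
  have e3 : (2 * ((p + 1 : ℕ) : ℝ) - 1) * θ = θ + π := by rw [← hmul]; push_cast; ring
  simp only [e0, e1, e2, e3, cos_neg, sin_neg, cos_pi_sub, sin_pi_sub, cos_add_pi,
    sin_add_pi] at h0 h1 h2 h3
  have hc : 0 < cos θ := cos_pos_of_mem_Ioo ⟨by linarith, hθ1⟩
  have hs : 0 < sin θ := sin_pos_of_pos_of_lt_pi hθ0 (by linarith)
  have f0 : cos θ * y 0 = 0 := by linarith
  have f1 : sin θ * y 1 = 0 := by linarith
  ext i
  fin_cases i
  · exact (mul_eq_zero.1 f0).resolve_left hc.ne'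
  · exact (mul_eq_zero.1 f1).resolve_left hs.ne'

theorem regularPolygon_eq {m : ℕ} [NeZero m] (hm : 4 ≤ m) (hev : Even m) :
    regularPolygon m = hPolyhedron (rowForm (regularMatrix m)) fun _ => cos (π / m) := by
  obtain ⟨R, hR⟩ := exists_norm_le_of_mem_hPolyhedron (regular_recession hm hev)
    fun _ => cos (π / m)
  rw [← convexHull_extremePoints_hPolyhedron (isCompact_hPolyhedron hR),
    (isNGon_regular hm).extremePoints_eq hm]
  rfl

end Regular

/-! ### Points on the moment curve and their Gale transform -/

section MomentCurve

open Polynomial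

/-- The points with parameters `0, …, N - 1` on the moment curve `t ↦ (t, t², …, t ^ D)`. -/
noncomputable def momentPoints (N D : ℕ) (i : Fin N) (j : Fin D) : ℝ := (i : ℝ) ^ ((j : ℕ) + 1)

variable {N D : ℕ}

theorem sum_mul_pow_eq_zero {w : Fin N → ℝ} (h0 : ∑ i, w i = 0)
    (h1 : ∑ i, w i • momentPoints N D i = 0) {k : ℕ} (hk : k ≤ D) :
    ∑ i, w i * (i : ℝ) ^ k = 0 := by
  rcases k with _ | k
  · simpa using h0
  · simpa [momentPoints] using congrFun h1 ⟨k, hk⟩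

/-- An affine dependence of points on the moment curve annihilates all polynomials of degree at most
`D`. -/
theorem sum_mul_eval_eq_zero {w : Fin N → ℝ} (h0 : ∑ i, w i = 0)
    (h1 : ∑ i, w i • momentPoints N D i = 0) {p : ℝ[X]} (hp : p.natDegree ≤ D) :
    ∑ i, w i * p.eval (i : ℝ) = 0 := by
  simp_rw [fun x : ℝ => eval_eq_sum_range' (Nat.lt_succ_of_le hp) x, Finset.mul_sum]
  rw [Finset.sum_comm]
  refine Finset.sum_eq_zero fun k hk => ?_
  have := sum_mul_pow_eq_zero h0 h1 (Nat.lt_succ_iff.1 (Finset.mem_range.1 hk))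
  calc ∑ i, w i * (p.coeff k * (i : ℝ) ^ k) = p.coeff k * ∑ i, w i * (i : ℝ) ^ k := by
        rw [Finset.mul_sum]
        exact Finset.sum_congr rfl fun i _ => by ring
    _ = 0 := by rw [this, mul_zero]

/-- An affine dependence of points on the moment curve has more than `D + 1` nonzero coefficients:
test it with a polynomial vanishing at all but one of the points. -/
theorem eq_zero_of_affine_dependence {w : Fin N → ℝ} (h0 : ∑ i, w i = 0)
    (h1 : ∑ i, w i • momentPoints N D i = 0) {s : Finset (Fin N)} (hs : s.card ≤ D + 1)
    (hw : ∀ i ∉ s, w i = 0) : w = 0 := by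
  classical
  funext i
  by_cases hi : i ∈ s
  · set p : ℝ[X] := ∏ k ∈ s.erase i, (X - C (k : ℝ)) with hp
    have hdeg : p.natDegree ≤ D := by
      rw [hp, natDegree_finsetProd_X_sub_C_eq_card, Finset.card_erase_of_mem hi]
      omega
    have hsum := sum_mul_eval_eq_zero h0 h1 hdeg
    rw [Finset.sum_eq_single i] at hsum
    · refine (mul_eq_zero.1 hsum).resolve_right ?_
      rw [hp, eval_prod, ← ne_eq, Finset.prod_ne_zero_iff]
      intro k hk
      rw [eval_sub, eval_X, eval_C, sub_ne_zero]
      exact fun h => (Finset.mem_erase.1 hk).1 (Fin.ext (Nat.cast_injective h.symm))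
    · intro k _ hki
      by_cases hk : k ∈ s
      · rw [hp, eval_prod, Finset.prod_eq_zero (Finset.mem_erase.2 ⟨hki, hk⟩) (by simp), mul_zero]
      · rw [hw k hk, zero_mul]
    · simp
  · exact hw i hi

theorem isNeighborlyGP_momentPoints (N D : ℕ) : IsNeighborlyGP (momentPoints N D) := by
  classical
  refine ⟨fun s hs => ?_, fun s hs => ?_⟩
  · rw [affineIndependent_iff]
    intro s' w h0 h1 i hi
    let w' : Fin N → ℝ := fun k =>
      if h : k ∈ s then (if (⟨k, h⟩ : s) ∈ s' then w ⟨k, h⟩ else 0) else 0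
    have key : ∀ {V : Type} [AddCommGroup V] [Module ℝ V] (f : Fin N → V),
        ∑ k, w' k • f k = ∑ k ∈ s', w k • f k := by
      intro V _ _ f
      rw [← Finset.sum_subset (Finset.subset_univ s), ← Finset.sum_coe_sort s]
      · rw [← Finset.sum_subset (Finset.subset_univ s')]
        · refine Finset.sum_congr rfl fun k hk => ?_
          simp [w', hk]
        · intro k _ hk
          simp [w', hk]
      · intro k _ hk
        simp [w', hk]
    have hw' : w' = 0 := by
      refine eq_zero_of_affine_dependence (D := D) ?_ ?_ hs.le fun k hk => by simp [w', hk]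
      · simpa [h0] using key fun _ => (1 : ℝ)
      · rw [key, h1]
    simpa [w', hi] using congrFun hw' (i : Fin N)
  · -- the polynomial with double zeros at the chosen parameters is positive elsewhere
    set p : ℝ[X] := ∏ k ∈ s, (X - C (k : ℝ)) ^ 2 with hp
    have hdeg : p.natDegree ≤ D := by
      rw [hp, Finset.prod_pow]
      refine natDegree_pow_le.trans ?_
      rw [natDegree_finsetProd_X_sub_C_eq_card]
      omega
    have hval : ∀ x : ℝ, p.eval x = ∏ k ∈ s, (x - k) ^ 2 := by
      intro x
      simp [hp, eval_prod]
    let l : (Fin D → ℝ) →ₗ[ℝ] ℝ := ∑ j : Fin D, (-p.coeff (j + 1)) • LinearMap.proj j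
    have hl : ∀ i, l (momentPoints N D i) = p.coeff 0 - p.eval (i : ℝ) := by
      intro i
      rw [eval_eq_sum_range' (Nat.lt_succ_of_le hdeg), Finset.sum_range_succ',
        ← Fin.sum_univ_eq_sum_range fun k => p.coeff (k + 1) * (i : ℝ) ^ (k + 1)]
      simp [l, momentPoints]
    refine ⟨l, p.coeff 0, fun i hi => ?_, fun i hi => ?_⟩
    · rw [hl, hval, Finset.prod_eq_zero hi (by simp), sub_zero]
    · rw [hl, hval, sub_lt_self_iff]
      refine Finset.prod_pos fun k hk => ?_
      have : (i : ℝ) - k ≠ 0 := by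
        rw [sub_ne_zero]
        exact fun h => hi (by rwa [Fin.ext (Nat.cast_injective h)])
      positivity

end MomentCurve

section Gale

variable {r d : ℕ}

theorem stack_of_lt (g : Matrix (Fin (d - 1)) (Fin (2 * r - d)) ℝ) {i : Fin (2 * r - 1)}
    (h : (i : ℕ) < 2 * r - d) (j : Fin (2 * r - d)) :
    stack g i j = if (i : ℕ) = j then 1 else 0 := dif_pos h

/-- The indices of the rows of a Gale transform below the identity matrix. -/
def lowerIndices (r d : ℕ) : Finset (Fin (2 * r - 1)) :=
  Finset.univ.filter fun i => 2 * r - d ≤ (i : ℕ)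

theorem card_lowerIndices (hd : 2 ≤ d) (hdr : d ≤ 2 * r) : (lowerIndices r d).card = d - 1 := by
  have h : (Finset.univ.filter fun i : Fin (2 * r - 1) => (i : ℕ) < 2 * r - d).card =
      2 * r - d := by
    rw [Fin.card_filter_val_lt]
    omega
  have h2 := Finset.card_filter_add_card_filter_not (s := (Finset.univ : Finset (Fin (2 * r - 1))))
    (fun i : Fin (2 * r - 1) => (i : ℕ) < 2 * r - d)
  simp only [not_lt, Finset.card_univ, Fintype.card_fin] at h2
  rw [lowerIndices]
  omega

/-- The lower part of the Gale transform of points on the moment curve that begins with an identity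
matrix: the negatives of the Lagrange basis polynomials for the last `d - 1` parameters, evaluated
at the first `2r - d` parameters. The value `0` is never used, as the row numbers stay below
`2r - 1` for `1 ≤ d ≤ 2r`. -/
noncomputable def galeLower (r d : ℕ) : Matrix (Fin (d - 1)) (Fin (2 * r - d)) ℝ := fun i j =>
  if h : 2 * r - d + (i : ℕ) < 2 * r - 1 then
    -(Lagrange.basis (lowerIndices r d) (fun k => ((k : ℕ) : ℝ))
      ⟨2 * r - d + (i : ℕ), h⟩).eval (j : ℝ)
  else 0

theorem stack_galeLower_of_le {i : Fin (2 * r - 1)} (h : 2 * r - d ≤ (i : ℕ))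
    (j : Fin (2 * r - d)) : stack (galeLower r d) i j =
      -(Lagrange.basis (lowerIndices r d) (fun k => ((k : ℕ) : ℝ)) i).eval (j : ℝ) := by
  have h1 : 2 * r - d + ((i : ℕ) - (2 * r - d)) = i := by omega
  rw [stack, dif_neg (by omega), galeLower]
  simp only [h1, i.isLt, dif_pos]

/-- The columns of the Gale transform are affine dependences, by Lagrange interpolation. -/
theorem sum_stack_galeLower_mul_eval (hd : 2 ≤ d) (hdr : d ≤ 2 * r) {p : Polynomial ℝ}
    (hp : p.natDegree ≤ d - 2) (j : Fin (2 * r - d)) :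
    ∑ i, stack (galeLower r d) i j * p.eval (i : ℝ) = 0 := by
  have hj := j.isLt
  have hinj : Set.InjOn (fun k : Fin (2 * r - 1) => ((k : ℕ) : ℝ)) (lowerIndices r d) :=
    fun a _ b _ hab => Fin.ext (Nat.cast_injective hab)
  have hdeg : p.degree < (lowerIndices r d).card := by
    rw [card_lowerIndices hd hdr]
    exact Polynomial.degree_le_natDegree.trans_lt (by exact_mod_cast (by omega))
  have hint := congrArg (Polynomial.eval (j : ℝ)) (Lagrange.eq_interpolate hinj hdeg)
  rw [Lagrange.interpolate_apply, Polynomial.eval_finsetSum] at hint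
  rw [← Finset.sum_filter_add_sum_filter_not Finset.univ
    fun i : Fin (2 * r - 1) => 2 * r - d ≤ (i : ℕ)]
  have h1 : ∑ i ∈ Finset.univ.filter (fun i : Fin (2 * r - 1) => 2 * r - d ≤ (i : ℕ)),
      stack (galeLower r d) i j * p.eval (i : ℝ) = -p.eval (j : ℝ) := by
    rw [hint, ← Finset.sum_neg_distrib]
    refine Finset.sum_congr rfl fun i hi => ?_
    rw [stack_galeLower_of_le (Finset.mem_filter.1 hi).2, Polynomial.eval_mul, Polynomial.eval_C]
    ring
  have h2 : ∑ i ∈ Finset.univ.filter (fun i : Fin (2 * r - 1) => ¬ 2 * r - d ≤ (i : ℕ)),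
      stack (galeLower r d) i j * p.eval (i : ℝ) = p.eval (j : ℝ) := by
    rw [Finset.sum_eq_single (⟨j, by omega⟩ : Fin (2 * r - 1))]
    · rw [stack_of_lt _ (by simp)]
      simp
    · intro i hi hij
      rw [stack_of_lt _ (not_le.1 (Finset.mem_filter.1 hi).2), if_neg fun h => hij (Fin.ext h),
        zero_mul]
    · intro h
      simp at h
      omega
  rw [h1, h2, neg_add_cancel]

theorem galeLower_column (hd : 2 ≤ d) (hdr : d ≤ 2 * r) (j : Fin (2 * r - d)) :
    ∑ i, stack (galeLower r d) i j = 0 ∧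
      ∑ i, stack (galeLower r d) i j • momentPoints (2 * r - 1) (d - 2) i = 0 := by
  constructor
  · simpa using sum_stack_galeLower_mul_eval hd hdr (p := 1) (by simp) j
  · ext k
    have hk := k.isLt
    simpa [momentPoints] using sum_stack_galeLower_mul_eval hd hdr
      (p := Polynomial.X ^ ((k : ℕ) + 1)) (by rw [Polynomial.natDegree_X_pow]; omega) j

/-- The affine dependences of a point configuration. -/
def affineDependences {N D : ℕ} (Q : Fin N → Fin D → ℝ) : Submodule ℝ (Fin N → ℝ) where
  carrier := {w | ∑ i, w i = 0 ∧ ∑ i, w i • Q i = 0}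
  zero_mem' := by simp
  add_mem' := by
    rintro a b ⟨ha, ha'⟩ ⟨hb, hb'⟩
    simp [Finset.sum_add_distrib, add_smul, ha, ha', hb, hb']
  smul_mem' := by
    rintro c a ⟨ha, ha'⟩
    simp [← Finset.mul_sum, mul_smul, ← Finset.smul_sum, ha, ha']

theorem isGaleTransform_galeLower (hd : 2 ≤ d) (hdr : d ≤ 2 * r) :
    IsGaleTransform (momentPoints (2 * r - 1) (d - 2)) (stack (galeLower r d)) := by
  have htop : ∀ (c : Fin (2 * r - d) → ℝ) (i : Fin (2 * r - 1)) (hi : (i : ℕ) < 2 * r - d),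
      ∑ j, c j * stack (galeLower r d) i j = c ⟨i, hi⟩ := by
    intro c i hi
    rw [Finset.sum_eq_single ⟨i, hi⟩]
    · rw [stack_of_lt _ hi, if_pos rfl, mul_one]
    · intro j _ hj
      rw [stack_of_lt _ hi, if_neg fun h => hj (Fin.ext h.symm), mul_zero]
    · simp
  constructor
  · rw [Fintype.linearIndependent_iff]
    intro c hc j
    have hj := j.isLt
    have h1 := congrFun hc (⟨j, by omega⟩ : Fin (2 * r - 1))
    simp only [Finset.sum_apply, Pi.smul_apply, smul_eq_mul, Pi.zero_apply] at h1
    rwa [htop c _ hj] at h1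
  · intro w
    have hcol : ∀ j, (fun i => stack (galeLower r d) i j) ∈
        affineDependences (momentPoints (2 * r - 1) (d - 2)) := galeLower_column hd hdr
    constructor
    · intro hw
      have : Submodule.span ℝ (Set.range fun j i => stack (galeLower r d) i j) ≤
          affineDependences (momentPoints (2 * r - 1) (d - 2)) := by
        rw [Submodule.span_le]
        rintro _ ⟨j, rfl⟩
        exact hcol j
      exact this hw
    · intro hw
      -- subtracting the combination of the columns with the same top entries leaves a dependence
      -- among the last `d - 1` points only
      set v : Fin (2 * r - 1) → ℝ := ∑ j : Fin (2 * r - d),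
        w ⟨j, by omega⟩ • fun i => stack (galeLower r d) i j with hv
      have hvmem : v ∈ affineDependences (momentPoints (2 * r - 1) (d - 2)) :=
        Submodule.sum_mem _ fun j _ => Submodule.smul_mem _ _ (hcol j)
      have hsub : w - v ∈ affineDependences (momentPoints (2 * r - 1) (d - 2)) :=
        Submodule.sub_mem _ hw hvmem
      have hzero : w - v = 0 := by
        refine eq_zero_of_affine_dependence hsub.1 hsub.2 (s := lowerIndices r d)
          (by rw [card_lowerIndices hd hdr]; omega) fun i hi => ?_
        have hi' : (i : ℕ) < 2 * r - d := by
          simpa only [lowerIndices, Finset.mem_filter, Finset.mem_univ, true_and, not_le] using hi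
        have := htop (fun j => w ⟨j, by omega⟩) i hi'
        simp only [hv, Pi.sub_apply, Finset.sum_apply, Pi.smul_apply, smul_eq_mul]
        rw [this, sub_self]
      rw [sub_eq_zero.1 hzero]
      exact Submodule.sum_mem _ fun j _ => Submodule.smul_mem _ _ (Submodule.subset_span ⟨j, rfl⟩)

end Gale

/-! ### Positive dependences and their stability -/

section Positive

open Filter Topology

/-- If the rows of a matrix span and have a linear dependence with positive coefficients, then so do
the rows of every matrix close to it. With a left inverse `N` of `R`, the coefficients `μ` are
corrected to `μ - μ R' (N R')⁻¹ N`, which depends continuously on `R'`. -/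
theorem exists_pos_vecMul_eq_zero {T K : Type*} [Fintype T] [Fintype K] [DecidableEq T]
    [DecidableEq K] (R : Matrix T K ℝ) (hinj : ∀ u, R.mulVec u = 0 → u = 0) {μ : T → ℝ}
    (hμ : ∀ t, 0 < μ t) (h0 : Matrix.vecMul μ R = 0) :
    ∃ ε > 0, ∀ R' : Matrix T K ℝ, (∀ t c, |R' t c - R t c| ≤ ε) →
      ∃ μ' : T → ℝ, (∀ t, 0 < μ' t) ∧ Matrix.vecMul μ' R' = 0 := by
  obtain ⟨f, hf⟩ := LinearMap.exists_leftInverse_of_injective R.mulVecLin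
    (LinearMap.ker_eq_bot'.2 hinj)
  set N : Matrix K T ℝ := LinearMap.toMatrix' f with hN
  have hNR : N * R = 1 := by
    rw [← LinearMap.toMatrix'_id, ← hf, LinearMap.toMatrix'_comp, ← Matrix.toLin'_apply',
      LinearMap.toMatrix'_toLin']
  let c : Matrix T K ℝ → T → ℝ := fun R' =>
    μ - Matrix.vecMul (Matrix.vecMul (Matrix.vecMul μ R') ((N * R').det⁻¹ • (N * R').adjugate)) N
  have hdet : Continuous fun R' : Matrix T K ℝ => (N * R').det := by fun_prop
  have hdet0 : (N * R).det ≠ 0 := by rw [hNR, Matrix.det_one]; exact one_ne_zero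
  have hcR : c R = μ := by simp only [c, h0, Matrix.zero_vecMul, sub_zero]
  have hcont : ContinuousAt c R := by
    have h1 : ContinuousAt (fun R' : Matrix T K ℝ => (N * R').det⁻¹ • (N * R').adjugate) R := by
      refine ContinuousAt.smul (hdet.continuousAt.inv₀ hdet0) ?_
      exact (Continuous.matrix_adjugate (by fun_prop)).continuousAt
    have h2 : Continuous fun p : (Matrix T K ℝ) × (Matrix K K ℝ) =>
        μ - Matrix.vecMul (Matrix.vecMul (Matrix.vecMul μ p.1) p.2) N := by fun_prop
    exact h2.continuousAt.comp (f := fun R' : Matrix T K ℝ =>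
      (R', (N * R').det⁻¹ • (N * R').adjugate)) (continuousAt_id.prodMk h1)
  have hev : ∀ᶠ R' in 𝓝 R, (N * R').det ≠ 0 ∧ ∀ t, 0 < c R' t := by
    refine (hdet.continuousAt.eventually_ne hdet0).and (eventually_all.2 fun t => ?_)
    have h3 : ContinuousAt (fun R' => c R' t) R := (continuous_apply t).continuousAt.comp hcont
    exact h3.eventually_const_lt (by simpa only [hcR] using hμ t)
  obtain ⟨ε, hε, hball⟩ :=
    (Metric.nhds_basis_closedBall (α := T → K → ℝ) (x := R)).eventually_iff.1 hev
  refine ⟨ε, hε, fun R' hR' => ⟨c R', ?_⟩⟩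
  obtain ⟨h1, h2⟩ := hball (x := (R' : T → K → ℝ)) ((dist_pi_le_iff hε.le).2 fun t =>
    (dist_pi_le_iff hε.le).2 fun k => hR' t k)
  refine ⟨h2, ?_⟩
  have hinv : ((N * R').det⁻¹ • (N * R').adjugate) * (N * R') = 1 := by
    rw [Matrix.smul_mul, Matrix.adjugate_mul, smul_smul, inv_mul_cancel₀ h1, one_smul]
  simp only [c]
  rw [Matrix.sub_vecMul, Matrix.vecMul_vecMul _ N, Matrix.vecMul_vecMul _ _ (N * R'), hinv,
    Matrix.vecMul_one, sub_self]

variable {r d : ℕ}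

/-- The rows of a Gale transform, preceded by a zero row. These are the limits, as `ε` tends to `0`,
of the truncated facet normals at a vertex of the deformed product. -/
def limitRows (g : Matrix (Fin (d - 1)) (Fin (2 * r - d)) ℝ) :
    Matrix (Fin (2 * r)) (Fin (2 * r - d)) ℝ := fun t c =>
  if h : (t : ℕ) = 0 then 0 else stack g ⟨(t : ℕ) - 1, by have := t.isLt; omega⟩ c

/-- Gale duality: the rows of the Gale transform outside a face of the neighborly polytope are
positively dependent, and they span. Both properties persist for rows that are close to these. -/
theorem exists_pos_dependence (hd : 2 ≤ d) (hdr : d ≤ 2 * r) (T : Finset (Fin (2 * r)))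
    (hT : 2 * r ≤ T.card + (d - 2) / 2) :
    ∃ ε > 0, ∀ R' : Matrix (Fin (2 * r)) (Fin (2 * r - d)) ℝ,
      (∀ t ∈ T, ∀ c, |R' t c - limitRows (galeLower r d) t c| ≤ ε) →
      ∃ μ : Fin (2 * r) → ℝ, (∀ t ∈ T, 0 < μ t) ∧ ∀ c, ∑ t ∈ T, μ t * R' t c = 0 := by
  classical
  set G := stack (galeLower r d) with hG
  let up : Fin (2 * r - 1) → Fin (2 * r) := fun i => ⟨(i : ℕ) + 1, by have := i.isLt; omega⟩
  have hup : ∀ i c, limitRows (galeLower r d) (up i) c = G i c := fun i c => by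
    simp [limitRows, up, hG]
  have hupinj : up.Injective := fun a b hab => Fin.ext (by simpa [up] using hab)
  let S : Finset (Fin (2 * r - 1)) := Finset.univ.filter fun i => up i ∉ T
  have hS : S.card ≤ (d - 2) / 2 := by
    have h1 : (S.image up).card ≤ Tᶜ.card := Finset.card_le_card fun t ht => by
      obtain ⟨i, hi, rfl⟩ := Finset.mem_image.1 ht
      simpa [S] using hi
    rw [Finset.card_image_of_injective _ hupinj, Finset.card_compl, Fintype.card_fin] at h1
    omega
  obtain ⟨hspan, hmem⟩ := isGaleTransform_galeLower hd hdr
  -- positive weights from the functional that exposes the face `S`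
  obtain ⟨l, a, hl, hl'⟩ := (isNeighborlyGP_momentPoints (2 * r - 1) (d - 2)).2 S hS
  have hdep : ∀ c, ∑ i, (a - l (momentPoints (2 * r - 1) (d - 2) i)) * G i c = 0 := by
    intro c
    obtain ⟨h1, h2⟩ := galeLower_column hd hdr c
    have h3 := congrArg l h2
    simp only [map_sum, map_smul, smul_eq_mul, map_zero] at h3
    simp only [sub_mul, Finset.sum_sub_distrib, ← Finset.mul_sum]
    rw [hG, h1, mul_zero, zero_sub, neg_eq_zero, ← h3]
    exact Finset.sum_congr rfl fun i _ => mul_comm _ _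
  let μ : Fin (2 * r) → ℝ := fun t => if h : (t : ℕ) = 0 then 1 else
    a - l (momentPoints (2 * r - 1) (d - 2) ⟨(t : ℕ) - 1, by have := t.isLt; omega⟩)
  have hμup : ∀ i, μ (up i) = a - l (momentPoints (2 * r - 1) (d - 2) i) := fun i => by
    simp [μ, up]
  have hcases : ∀ t : Fin (2 * r), (t : ℕ) = 0 ∨ ∃ i, t = up i := by
    intro t
    by_cases h : (t : ℕ) = 0
    · exact Or.inl h
    · exact Or.inr ⟨⟨(t : ℕ) - 1, by have := t.isLt; omega⟩, Fin.ext (by simp [up]; omega)⟩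
  have hzrow : ∀ t : Fin (2 * r), (t : ℕ) = 0 → ∀ c, limitRows (galeLower r d) t c = 0 :=
    fun t ht c => by simp [limitRows, ht]
  have hμT : ∀ c, ∑ t ∈ T, μ t * limitRows (galeLower r d) t c = 0 := by
    intro c
    rw [← hdep c, ← Finset.sum_subset (Finset.subset_univ (Finset.univ.filter fun i => up i ∈ T))]
    · simp_rw [← hup _ c, ← hμup]
      rw [← Finset.sum_image (f := fun t => μ t * limitRows (galeLower r d) t c) hupinj.injOn]
      symm
      refine Finset.sum_subset (fun t ht => ?_) fun t ht ht' => ?_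
      · obtain ⟨i, hi, rfl⟩ := Finset.mem_image.1 ht
        simpa using hi
      · rcases hcases t with h | ⟨i, rfl⟩
        · rw [hzrow t h, mul_zero]
        · exact absurd (Finset.mem_image_of_mem up (by simpa using ht)) ht'
    · intro i _ hi
      rw [hl i (by simpa [S] using hi), sub_self, zero_mul]
  let R : Matrix T (Fin (2 * r - d)) ℝ := fun t c => limitRows (galeLower r d) t c
  have hinj : ∀ u, R.mulVec u = 0 → u = 0 := by
    intro u hu
    have hGu : ∀ i ∉ S, ∑ c, u c * G i c = 0 := by
      intro i hi
      have hi' : up i ∈ T := by simpa [S] using hi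
      have := congrFun hu ⟨up i, hi'⟩
      simp only [Matrix.mulVec, dotProduct, R, hup, Pi.zero_apply] at this
      rw [← this]
      exact Finset.sum_congr rfl fun c _ => mul_comm _ _
    have hv : (∑ c, u c • fun i => G i c) ∈ affineDependences (momentPoints (2 * r - 1) (d - 2)) :=
      Submodule.sum_mem _ fun c _ => Submodule.smul_mem _ _ (galeLower_column hd hdr c)
    have hv0 := eq_zero_of_affine_dependence hv.1 hv.2 (s := S) (by omega)
      fun i hi => by simpa using hGu i hi
    exact funext (Fintype.linearIndependent_iff.1 hspan u hv0)
  have hpos : ∀ t : T, 0 < μ t := by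
    rintro ⟨t, ht⟩
    rcases hcases t with h | ⟨i, rfl⟩
    · simp [μ, h]
    · have hi : i ∉ S := by simpa [S] using ht
      simp only [hμup]
      linarith [hl' i hi]
  have hzero : Matrix.vecMul (fun t : T => μ t) R = 0 := by
    funext c
    have := hμT c
    rw [← Finset.sum_coe_sort T] at this
    simpa [Matrix.vecMul, dotProduct, R] using this
  obtain ⟨ε, hε, hstab⟩ := exists_pos_vecMul_eq_zero R hinj hpos hzero
  refine ⟨ε, hε, fun R' hR' => ?_⟩
  obtain ⟨μ', hpos, hz⟩ := hstab (fun t c => R' t c) fun t c => hR' t t.2 c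
  refine ⟨fun t => if h : t ∈ T then μ' ⟨t, h⟩ else 0, fun t ht => ?_, fun c => ?_⟩
  · simpa [ht] using hpos ⟨t, ht⟩
  · have := congrFun hz c
    simp only [Matrix.vecMul, dotProduct, Pi.zero_apply] at this
    rw [← Finset.sum_coe_sort T, ← this]
    exact Finset.sum_congr rfl fun t _ => by simp

/-- One bound on the perturbation serves for all faces of small dimension. -/
theorem exists_uniform_pos_dependence (hd : 2 ≤ d) (hdr : d ≤ 2 * r) :
    ∃ ε > 0, ∀ T : Finset (Fin (2 * r)), 2 * r ≤ T.card + (d - 2) / 2 →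
      ∀ R' : Matrix (Fin (2 * r)) (Fin (2 * r - d)) ℝ,
      (∀ t ∈ T, ∀ c, |R' t c - limitRows (galeLower r d) t c| ≤ ε) →
      ∃ μ : Fin (2 * r) → ℝ, (∀ t ∈ T, 0 < μ t) ∧ ∀ c, ∑ t ∈ T, μ t * R' t c = 0 := by
  have h : ∀ T : Finset (Fin (2 * r)), ∃ ε > 0, 2 * r ≤ T.card + (d - 2) / 2 →
      ∀ R' : Matrix (Fin (2 * r)) (Fin (2 * r - d)) ℝ,
      (∀ t ∈ T, ∀ c, |R' t c - limitRows (galeLower r d) t c| ≤ ε) →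
      ∃ μ : Fin (2 * r) → ℝ, (∀ t ∈ T, 0 < μ t) ∧ ∀ c, ∑ t ∈ T, μ t * R' t c = 0 := by
    intro T
    by_cases hT : 2 * r ≤ T.card + (d - 2) / 2
    · obtain ⟨ε, hε, h⟩ := exists_pos_dependence hd hdr T hT
      exact ⟨ε, hε, fun _ => h⟩
    · exact ⟨1, one_pos, fun h => absurd h hT⟩
  choose e he hdep using h
  obtain ⟨T₀, hT₀⟩ := Finite.exists_min e
  exact ⟨e T₀, he T₀, fun T hT R' hR' => hdep T hT R' fun t ht c => (hR' t ht c).trans (hT₀ T)⟩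

end Positive

/-! ### Polytopes with prescribed incidences, and their projections -/

section Simple

variable {ι E W : Type*} [AddCommGroup E] [Module ℝ E] [AddCommGroup W] [Module ℝ W]

theorem isExposed_empty [TopologicalSpace E] (X : Set E) : IsExposed ℝ X ∅ :=
  fun h => absurd h Set.not_nonempty_empty

theorem polyDim_empty : polyDim (∅ : Set E) = 0 := by
  rw [polyDim, vectorSpan_empty, finrank_bot]

theorem vectorSpan_image_linearMap (f : E →ₗ[ℝ] W) (s : Set E) :
    vectorSpan ℝ (f '' s) = (vectorSpan ℝ s).map f :=
  (AffineMap.map_vectorSpan f.toAffineMap (s := s)).symm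

theorem IsPolytope.image {P : Set E} (hP : IsPolytope P) (f : E →ₗ[ℝ] W) : IsPolytope (f '' P) := by
  classical
  obtain ⟨s, hs, rfl⟩ := hP
  exact ⟨s.image f, hs.image f, by rw [f.image_convexHull, Finset.coe_image]⟩

/-- The members of `𝒜` are exactly the sets of tight inequalities of points of the polyhedron. For a
simple polytope, `𝒜` is the boundary complex of the dual polytope, including the empty set. -/
def HasIncidences (n : ι → E →ₗ[ℝ] ℝ) (β : ι → ℝ) (𝒜 : Set (Finset ι)) : Prop :=
  ∀ J, (∃ x, HasActiveSet n β x J) ↔ J ∈ 𝒜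

/-- `𝒜` is closed under taking subsets and all its maximal members have `N` elements. -/
def IsPureComplex (𝒜 : Set (Finset ι)) (N : ℕ) : Prop :=
  (∀ J J', J ⊆ J' → J' ∈ 𝒜 → J ∈ 𝒜) ∧ ∀ J ∈ 𝒜, ∃ J' ∈ 𝒜, J ⊆ J' ∧ J'.card = N

/-- The face `hFace n β J` is the set of maximizers of a linear functional that factors through the
projection `π`. -/
def IsPreserved (n : ι → E →ₗ[ℝ] ℝ) (β : ι → ℝ)
    (π : E →ₗ[ℝ] W) (J : Finset ι) : Prop :=
  ∃ (l : W →ₗ[ℝ] ℝ) (c : ℝ), (∀ x ∈ hFace n β J, l (π x) = c) ∧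
    ∀ x ∈ hPolyhedron n β, x ∉ hFace n β J → l (π x) < c

variable {n : ι → E →ₗ[ℝ] ℝ} {β : ι → ℝ} {𝒜 : Set (Finset ι)} {N : ℕ} {π : E →ₗ[ℝ] W}
  {J J' : Finset ι}

theorem HasIncidences.hFace_subset_iff (h : HasIncidences n β 𝒜) (hJ : J ∈ 𝒜) :
    hFace n β J ⊆ hFace n β J' ↔ J' ⊆ J := by
  obtain ⟨x, hx⟩ := (h J).2 hJ
  exact hx.hFace_subset_iff

theorem HasIncidences.hFace_nonempty (h : HasIncidences n β 𝒜) (hJ : J ∈ 𝒜) :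
    (hFace n β J).Nonempty := by
  obtain ⟨x, hx⟩ := (h J).2 hJ
  exact ⟨x, hx.mem_hFace⟩

theorem IsPreserved.mem_hFace (h : IsPreserved n β π J) {x : E} (hx : x ∈ hPolyhedron n β)
    (hπ : π x ∈ π '' hFace n β J) : x ∈ hFace n β J := by
  obtain ⟨l, c, h1, h2⟩ := h
  obtain ⟨y, hy, hyx⟩ := hπ
  by_contra hcon
  have h3 := h1 y hy
  rw [hyx] at h3
  exact (h2 x hx hcon).ne h3

theorem IsPreserved.image_subset_iff (h : HasIncidences n β 𝒜) (hJ : J ∈ 𝒜)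
    (h' : IsPreserved n β π J') : π '' hFace n β J ⊆ π '' hFace n β J' ↔ J' ⊆ J := by
  refine ⟨fun hs => ?_, fun hs => Set.image_mono ((h.hFace_subset_iff hJ).2 hs)⟩
  obtain ⟨x, hx⟩ := (h J).2 hJ
  have := h'.mem_hFace hx.1 (hs ⟨x, hx.mem_hFace, rfl⟩)
  exact fun i hi => (hx.2 i).1 (this.2 i hi)

variable [TopologicalSpace W] [IsTopologicalAddGroup W] [ContinuousSMul ℝ W] [T2Space W]
  [FiniteDimensional ℝ W]

theorem IsPreserved.isExposed (h : IsPreserved n β π J) :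
    IsExposed ℝ (π '' hPolyhedron n β) (π '' hFace n β J) := by
  obtain ⟨l, c, h1, h2⟩ := h
  refine isExposed_of_forall_lt l c (Set.image_mono fun x hx => hx.1) ?_ ?_
  · rintro _ ⟨x, hx, rfl⟩
    exact h1 x hx
  · rintro _ ⟨x, hx, rfl⟩ hx'
    exact h2 x hx fun hxJ => hx' ⟨x, hxJ, rfl⟩

variable [TopologicalSpace E] [IsTopologicalAddGroup E] [ContinuousSMul ℝ E] [T2Space E]
  [FiniteDimensional ℝ E]
  {E' : Type*} [AddCommGroup E'] [Module ℝ E'] [TopologicalSpace E'] [IsTopologicalAddGroup E']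
  [ContinuousSMul ℝ E'] [T2Space E'] [FiniteDimensional ℝ E']
  {n' : ι → E' →ₗ[ℝ] ℝ} {β' : ι → ℝ}

/-- The dimension of a face of a simple polytope. -/
theorem HasIncidences.polyDim_hFace (h : HasIncidences n β 𝒜) (hp : IsPureComplex 𝒜 N)
    (hE : Module.finrank ℝ E = N) {J : Finset ι} (hJ : J ∈ 𝒜) :
    polyDim (hFace n β J) + J.card = N := by
  have hchain : ∀ J₁ J₂ : Finset ι, J₁ ⊆ J₂ → J₂ ∈ 𝒜 →
      polyDim (hFace n β J₂) + J₂.card ≤ polyDim (hFace n β J₁) + J₁.card := fun J₁ J₂ h12 h2 =>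
    polyDim_add_card_le hp.1 (X := hPolyhedron n β) (k := 0) (fun J hJ _ => h.hFace_nonempty hJ)
      (fun J _ _ => isExposed_hFace J) (fun J hJ _ J' _ _ => h.hFace_subset_iff hJ) h12 h2
      (Nat.zero_le _)
  obtain ⟨J', hJ', hsub, hcard⟩ := hp.2 J hJ
  have h1 := hchain J J' hsub hJ'
  have h2 := hchain ∅ J (Finset.empty_subset J) hJ
  have h3 : polyDim (hFace n β ∅) ≤ N := hE ▸ Submodule.finrank_le _
  rw [Finset.card_empty] at h2
  omega

/-- Polyhedra with the same incidences are combinatorially equivalent. -/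
theorem HasIncidences.combEquiv [Finite ι] (h : HasIncidences n β 𝒜)
    (h' : HasIncidences n' β' 𝒜) : CombEquiv (hPolyhedron n β) (hPolyhedron n' β') := by
  refine nonempty_orderIso_of_families (α := 𝒜) (isExposed_empty _) (isExposed_empty _)
    (fun J => hFace n β J) (fun J => hFace n' β' J) (fun J => isExposed_hFace _)
    (fun J => isExposed_hFace _) (fun J => h.hFace_nonempty J.2) (fun J => h'.hFace_nonempty J.2)
    ?_ ?_ fun J J' => (h.hFace_subset_iff J.2).trans (h'.hFace_subset_iff J.2).symm
  · intro S hS hne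
    obtain ⟨J, hJ, rfl⟩ := exists_eq_hFace_of_isExposed hS hne
    exact ⟨⟨J, (h J).1 hJ⟩, rfl⟩
  · intro S hS hne
    obtain ⟨J, hJ, rfl⟩ := exists_eq_hFace_of_isExposed hS hne
    exact ⟨⟨J, (h' J).1 hJ⟩, rfl⟩

/-- If a projection preserves all faces of dimension at most `k` of a simple polytope, then these
are all the faces of dimension at most `k` of the image. Indeed a further face of the image would be
the image of a face of higher dimension, and would properly contain the image of a `k`-face. -/
theorem HasIncidences.skeletonIso_image [Finite ι] (h : HasIncidences n β 𝒜)
    (h' : HasIncidences n' β' 𝒜) (hp : IsPureComplex 𝒜 N) (hE : Module.finrank ℝ E = N)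
    (hE' : Module.finrank ℝ E' = N) {k : ℕ} (hk : k ≤ N)
    (hπ : ∀ J ∈ 𝒜, N ≤ J.card + k → IsPreserved n β π J) :
    SkeletonIso k (π '' hPolyhedron n β) (hPolyhedron n' β') := by
  refine nonempty_orderIso_of_families (α := {J // J ∈ 𝒜 ∧ N ≤ J.card + k})
    ⟨isExposed_empty _, polyDim_empty.trans_le k.zero_le⟩
    ⟨isExposed_empty _, polyDim_empty.trans_le k.zero_le⟩
    (fun J => π '' hFace n β J) (fun J => hFace n' β' J)
    (fun J => ⟨(hπ J J.2.1 J.2.2).isExposed, ?_⟩) (fun J => ⟨isExposed_hFace _, ?_⟩)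
    (fun J => (h.hFace_nonempty J.2.1).image π) (fun J => h'.hFace_nonempty J.2.1) ?_ ?_
    fun J J' => (IsPreserved.image_subset_iff h J.2.1 (hπ J' J'.2.1 J'.2.2)).trans
      (h'.hFace_subset_iff J.2.1).symm
  · have h1 := h.polyDim_hFace hp hE J.2.1
    have h2 : polyDim (π '' hFace n β J) ≤ polyDim (hFace n β J) := by
      rw [polyDim, vectorSpan_image_linearMap]
      exact Submodule.finrank_map_le _ _
    have := J.2.2
    omega
  · have h1 := h'.polyDim_hFace hp hE' J.2.1
    have := J.2.2
    omega
  · rintro S ⟨hS, hSk⟩ hne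
    -- the preimage of `S` is a face
    have hG : IsExposed ℝ (hPolyhedron n β) {x | x ∈ hPolyhedron n β ∧ π x ∈ S} := by
      intro _
      obtain ⟨l, hl⟩ := hS hne
      refine ⟨LinearMap.toContinuousLinearMap ((l : W →ₗ[ℝ] ℝ) ∘ₗ π), ?_⟩
      ext x
      refine and_congr_right fun hx => ?_
      rw [hl]
      simp only [Set.mem_ofPred_eq, LinearMap.coe_toContinuousLinearMap', LinearMap.comp_apply,
        ContinuousLinearMap.coe_coe, Set.forall_mem_image]
      exact and_iff_right (Set.mem_image_of_mem π hx)
    have hSG : S = π '' {x | x ∈ hPolyhedron n β ∧ π x ∈ S} := by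
      apply Set.Subset.antisymm
      · intro z hz
        obtain ⟨x, hx, rfl⟩ := hS.subset hz
        exact ⟨x, ⟨hx, hz⟩, rfl⟩
      · rintro _ ⟨x, hx, rfl⟩
        exact hx.2
    have hGne : {x | x ∈ hPolyhedron n β ∧ π x ∈ S}.Nonempty := by
      rw [hSG] at hne
      exact hne.of_image
    obtain ⟨J, ⟨x, hx⟩, hJ⟩ := exists_eq_hFace_of_isExposed hG hGne
    rw [hJ] at hSG
    have hJA : J ∈ 𝒜 := (h J).1 ⟨x, hx⟩
    refine ⟨⟨J, hJA, ?_⟩, hSG.symm⟩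
    by_contra hcon
    obtain ⟨J₁, hJ₁, hsub, hcard⟩ := hp.2 J hJA
    obtain ⟨J₂, hJ₂, hJ₂₁, hcard₂⟩ := Finset.exists_subsuperset_card_eq hsub
      (n := N - k) (by omega) (by omega)
    have hJ₂A := hp.1 _ _ hJ₂₁ hJ₁
    have h2 := hπ J₂ hJ₂A (by omega)
    have hchain := polyDim_add_card_le hp.1 (X := π '' hPolyhedron n β)
      (F := fun J => π '' hFace n β J) (k := N - k)
      (fun J hJ _ => (h.hFace_nonempty hJ).image π)
      (fun J hJ hc => (hπ J hJ (by omega)).isExposed)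
      (fun J hJ _ J' hJ' hc => IsPreserved.image_subset_iff h hJ (hπ J' hJ' (by omega)))
      hJ₂₁ hJ₁ hcard₂.ge
    have hlt : polyDim (π '' hFace n β J₂) < polyDim S := by
      refine polyDim_lt_of_ssubset h2.isExposed ((h.hFace_nonempty hJ₂A).image π) ⟨?_, ?_⟩ hS.subset
      · rw [hSG]
        exact Set.image_mono ((h.hFace_subset_iff hJ₂A).2 hJ₂)
      · rw [hSG, IsPreserved.image_subset_iff h hJA h2]
        intro hcon2
        have := Finset.card_le_card hcon2
        omega
    omega
  · rintro S ⟨hS, hSk⟩ hne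
    obtain ⟨J, hJ, rfl⟩ := exists_eq_hFace_of_isExposed hS hne
    have hJA := (h' J).1 hJ
    have h1 := h'.polyDim_hFace hp hE' hJA
    exact ⟨⟨J, hJA, by omega⟩, rfl⟩

end Simple

/-! ### The face structure of products of polygons -/

section Product

/-- The incidences of a product of `r` polygons with `m` edges: in each factor, at most two
inequalities are tight, and they belong to adjacent edges. -/
def polygonComplex (m r : ℕ) [NeZero m] : Set (Finset (Fin r × Fin m)) :=
  {J | ∀ j, ∃ k, ∀ i, (j, i) ∈ J → i = k ∨ i = k + 1}

variable {m r : ℕ} [NeZero m]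

theorem isPureComplex_polygonComplex (hm : 4 ≤ m) :
    IsPureComplex (polygonComplex m r) (2 * r) := by
  refine ⟨fun J J' hJ hJ' j => ?_, fun J hJ => ?_⟩
  · obtain ⟨k, hk⟩ := hJ' j
    exact ⟨k, fun i hi => hk i (hJ hi)⟩
  · choose f hf using hJ
    refine ⟨Finset.univ.filter fun p => p.2 = f p.1 ∨ p.2 = f p.1 + 1, ?_, ?_, ?_⟩
    · exact fun j => ⟨f j, fun i hi => by simpa using hi⟩
    · rintro ⟨j, i⟩ hp
      simpa using hf j i hp
    · rw [Finset.card_filter, Fintype.sum_prod_type]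
      have h : ∀ j : Fin r, ∑ i : Fin m, (if i = f j ∨ i = f j + 1 then 1 else 0) = 2 := by
        intro j
        rw [← Finset.card_filter, ← Finset.card_pair (fin_add_one_ne hm (f j)).1.symm]
        congr 1
        ext i
        simp
      simp [h, mul_comm]

/-- The inequalities of the product of regular polygons. -/
noncomputable def productForm (m r : ℕ) (p : Fin r × Fin m) : (Fin r → Fin 2 → ℝ) →ₗ[ℝ] ℝ :=
  rowForm (regularMatrix m) p.2 ∘ₗ LinearMap.proj p.1

theorem polygonProduct_eq (hm : 4 ≤ m) (hev : Even m) :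
    polygonProduct m r = hPolyhedron (productForm m r) fun _ => Real.cos (Real.pi / m) := by
  ext x
  simp only [polygonProduct, regularPolygon_eq hm hev, Set.mem_pi, Set.mem_univ, true_imp_iff]
  exact ⟨fun h p => h p.1 p.2, fun h j i => h (j, i)⟩

theorem hasIncidences_product (hm : 4 ≤ m) :
    HasIncidences (productForm m r) (fun _ => Real.cos (Real.pi / m)) (polygonComplex m r) := by
  classical
  have hng := isNGon_regular hm
  intro J
  constructor
  · rintro ⟨x, hx⟩ j
    obtain ⟨k, hk⟩ := hng.exists_active_subset hm (x := x j) fun i => hx.1 (j, i)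
    exact ⟨k, fun i hi => hk i ((hx.2 (j, i)).2 hi)⟩
  · intro hJ
    have : ∀ j, ∃ y, HasActiveSet (rowForm (regularMatrix m)) (fun _ => Real.cos (Real.pi / m)) y
        (Finset.univ.filter fun i => (j, i) ∈ J) := by
      intro j
      obtain ⟨k, hk⟩ := hJ j
      exact hng.exists_hasActiveSet hm (k := k) fun i hi => hk i (by simpa using hi)
    choose y hy using this
    exact ⟨y, fun p => (hy p.1).1 p.2, fun p => ((hy p.1).2 p.2).trans (by simp)⟩

end Product

/-! ### The face structure of the deformed product -/

section Deformed

variable {m r d : ℕ} {ε : ℝ} {g : Matrix (Fin (d - 1)) (Fin (2 * r - d)) ℝ}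

/-- The coordinates of a point that belong to the polygon `j`. -/
def block (x : Fin (2 * r) → ℝ) (j : Fin r) : Fin 2 → ℝ := fun e =>
  x ⟨2 * (j : ℕ) + (e : ℕ), by have := j.isLt; have := e.isLt; omega⟩

/-- The part of a row of the deformed product to the left of the diagonal block. -/
noncomputable def lowerPart (g : Matrix (Fin (d - 1)) (Fin (2 * r - d)) ℝ) (p : Fin r × Fin m)
    (x : Fin (2 * r) → ℝ) : ℝ :=
  ∑ c : Fin (2 * r), if h : (c : ℕ) / 2 < (p.1 : ℕ) ∧ (c : ℕ) < 2 * r - d then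
    stack g ⟨2 * (p.1 : ℕ) + (p.2 : ℕ) % 2 - 1, by have := p.1.isLt; omega⟩ ⟨(c : ℕ), h.2⟩ * x c
  else 0

theorem rowForm_dppMatrix (p : Fin r × Fin m) (x : Fin (2 * r) → ℝ) :
    rowForm (dppMatrix m r d ε g) p x =
      rowForm (polygonMatrix m ε) p.2 (block x p.1) + lowerPart g p x := by
  have hj := p.1.isLt
  have h1 : rowForm (polygonMatrix m ε) p.2 (block x p.1) = ∑ c : Fin (2 * r),
      if (c : ℕ) / 2 = p.1 then
        polygonMatrix m ε p.2 ⟨(c : ℕ) % 2, Nat.mod_lt _ (by norm_num)⟩ * x c else 0 := by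
    rw [rowForm_fin_two, Finset.sum_eq_add (⟨2 * p.1, by omega⟩ : Fin (2 * r))
      ⟨2 * p.1 + 1, by omega⟩]
    · have e1 : 2 * (p.1 : ℕ) / 2 = p.1 := by omega
      have e2 : (2 * (p.1 : ℕ) + 1) / 2 = p.1 := by omega
      have e3 : 2 * (p.1 : ℕ) % 2 = 0 := by omega
      have e4 : (2 * (p.1 : ℕ) + 1) % 2 = 1 := by omega
      simp only [e1, e2, e3, e4, if_true, block]
      rfl
    · simp
    · intro c _ hc
      rw [if_neg]
      simp only [ne_eq, Fin.ext_iff] at hc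
      omega
    · simp
    · simp
  rw [h1, lowerPart, ← Finset.sum_add_distrib, rowForm_apply, Matrix.mulVec, dotProduct]
  refine Finset.sum_congr rfl fun c _ => ?_
  simp only [dppMatrix]
  by_cases hc : (c : ℕ) / 2 = p.1
  · rw [if_pos hc, if_pos hc, dif_neg (by omega), add_zero]
  · rw [if_neg hc, if_neg hc, zero_add]
    split_ifs <;> simp

theorem lowerPart_congr {p : Fin r × Fin m} {x y : Fin (2 * r) → ℝ}
    (h : ∀ c : Fin (2 * r), (c : ℕ) / 2 < p.1 → x c = y c) : lowerPart g p x = lowerPart g p y := by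
  refine Finset.sum_congr rfl fun c _ => ?_
  split_ifs with hc
  · rw [h c hc.1]
  · rfl

/-- If the scaling factors grow fast enough, the lower part of the matrix only causes a small
perturbation of the right hand sides. -/
theorem exists_scaling (m : ℕ) (g : Matrix (Fin (d - 1)) (Fin (2 * r - d)) ℝ) {η R : ℝ}
    (hη : 0 < η) (hR : 0 ≤ R) :
    ∃ t : ℝ, 1 ≤ t ∧ ∀ (j : Fin r) (x : Fin (2 * r) → ℝ),
      (∀ c : Fin (2 * r), (c : ℕ) / 2 < j → |x c| ≤ R * t ^ ((c : ℕ) / 2)) →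
      ∀ i : Fin m, |lowerPart g (j, i) x| ≤ η * t ^ (j : ℕ) := by
  set γ : ℝ := ∑ i, ∑ c, |stack g i c| with hγ
  have hγ0 : 0 ≤ γ := Finset.sum_nonneg fun i _ => Finset.sum_nonneg fun c _ => abs_nonneg _
  have hle : ∀ i c, |stack g i c| ≤ γ := fun i c =>
    (Finset.single_le_sum (f := fun c => |stack g i c|) (fun c _ => abs_nonneg _)
      (Finset.mem_univ c)).trans (Finset.single_le_sum (f := fun i => ∑ c, |stack g i c|)
        (fun i _ => Finset.sum_nonneg fun c _ => abs_nonneg _) (Finset.mem_univ i))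
  set t : ℝ := 1 + (2 * r : ℕ) * (γ * R) / η with ht
  have ht1 : 1 ≤ t := by
    rw [ht]
    have : 0 ≤ (2 * r : ℕ) * (γ * R) / η := by positivity
    linarith
  have ht0 : 0 < t := one_pos.trans_le ht1
  refine ⟨t, ht1, fun j x hx i => ?_⟩
  have hterm : t * |lowerPart g (j, i) x| ≤ t * (η * t ^ (j : ℕ)) := by
    calc t * |lowerPart g (j, i) x|
        ≤ t * ∑ c : Fin (2 * r), γ * R * (t ^ (j : ℕ) / t) := by
          refine mul_le_mul_of_nonneg_left ((Finset.abs_sum_le_sum_abs _ _).trans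
            (Finset.sum_le_sum fun c _ => ?_)) ht0.le
          split_ifs with hc
          · have hpow : t ^ ((c : ℕ) / 2) ≤ t ^ (j : ℕ) / t := by
              rw [le_div_iff₀ ht0, ← pow_succ]
              exact pow_le_pow_right₀ ht1 hc.1
            rw [abs_mul, mul_assoc]
            exact mul_le_mul (hle _ _) ((hx c hc.1).trans (by gcongr)) (abs_nonneg _) hγ0
          · rw [abs_zero]
            positivity
      _ = (2 * r : ℕ) * (γ * R) * t ^ (j : ℕ) := by
          rw [Finset.sum_const, Finset.card_univ, Fintype.card_fin, nsmul_eq_mul]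
          field_simp
      _ ≤ (η * t) * t ^ (j : ℕ) := by
          refine mul_le_mul_of_nonneg_right ?_ (by positivity)
          rw [ht]
          field_simp
          linarith
      _ = t * (η * t ^ (j : ℕ)) := by ring
  exact le_of_mul_le_mul_left hterm ht0

/-- Suitable scaling factors make the deformed product a bounded polyhedron with the incidences of a
product of polygons. Each block of coordinates of a point lies in a slightly perturbed and rescaled
special polygon. -/
theorem exists_hasIncidences_dpp [NeZero m] (hm : 4 ≤ m) (hε : 0 < ε)
    (g : Matrix (Fin (d - 1)) (Fin (2 * r - d)) ℝ) :
    ∃ M : Fin r → ℝ, (∀ j, 0 < M j) ∧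
      (∃ B, ∀ x ∈ dpp m r d ε g (specialRhs m) M, ‖x‖ ≤ B) ∧
      HasIncidences (rowForm (dppMatrix m r d ε g))
        (fun p => M p.1 * (scale ε p.2 * specialRhs m p.2)) (polygonComplex m r) := by
  classical
  set A := polygonMatrix m ε with hA
  set β : Fin m → ℝ := fun i => scale ε i * specialRhs m i with hβ
  have hng : IsNGon A β (specialVertex m ε) := isNGon_special hm hε
  obtain ⟨η, hη, hpert⟩ := hng.exists_perturbation hm
  obtain ⟨R₀, hR₀⟩ := exists_norm_le_of_mem_hPolyhedron (special_recession hm hε) fun i => β i + η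
  set R := max R₀ 0 with hR
  obtain ⟨t, ht1, ht⟩ := exists_scaling (r := r) (d := d) m g hη (le_max_right R₀ 0)
  have ht0 : 0 < t := one_pos.trans_le ht1
  have hpow : ∀ j : ℕ, 0 < t ^ j := fun j => pow_pos ht0 j
  -- the inequalities of the polygon `j`, for given coordinates in the previous blocks
  have hiff : ∀ (j : Fin r) (i : Fin m) (x : Fin (2 * r) → ℝ) (y : Fin 2 → ℝ),
      block x j = t ^ (j : ℕ) • y →
      rowForm (dppMatrix m r d ε g) (j, i) x - t ^ (j : ℕ) * β i =
        t ^ (j : ℕ) * (rowForm A i y - (β i - lowerPart g (j, i) x / t ^ (j : ℕ))) := by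
    intro j i x y hy
    have := (hpow j).ne'
    rw [rowForm_dppMatrix, hy, map_smul, smul_eq_mul]
    field_simp
    ring
  have hsmul : ∀ (x : Fin (2 * r) → ℝ) (j : Fin r),
      block x j = t ^ (j : ℕ) • ((t ^ (j : ℕ))⁻¹ • block x j) := fun x j => by
    rw [smul_smul, mul_inv_cancel₀ (hpow j).ne', one_smul]
  -- the coordinates of the first blocks are bounded
  have hbound : ∀ (x : Fin (2 * r) → ℝ) (s : ℕ), (∀ j : Fin r, (j : ℕ) < s →
      ∀ i, rowForm (dppMatrix m r d ε g) (j, i) x ≤ t ^ (j : ℕ) * β i) →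
      ∀ c : Fin (2 * r), (c : ℕ) / 2 < s → |x c| ≤ R * t ^ ((c : ℕ) / 2) := by
    intro x s
    induction s with
    | zero => intro _ c hc; omega
    | succ s ih =>
      intro hx c hc
      have ih' := ih fun j hj => hx j (by omega)
      rcases Nat.lt_succ_iff_lt_or_eq.1 hc with hc | hc
      · exact ih' c hc
      · have hcr := c.isLt
        let j : Fin r := ⟨s, by omega⟩
        have hlow := ht j x ih'
        have hmem : (t ^ s)⁻¹ • block x j ∈ hPolyhedron (rowForm A) fun i => β i + η := by
          intro i
          have h1 := hiff j i x _ (hsmul x j)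
          have h2 := sub_nonpos.2 (hx j (Nat.lt_succ_self s) i)
          rw [h1] at h2
          have h3 := nonpos_of_mul_nonpos_right h2 (hpow s)
          have h4 : -η ≤ lowerPart g (j, i) x / t ^ s := by
            rw [le_div_iff₀ (hpow s)]
            have := (abs_le.1 (hlow i)).1
            simpa [j] using this
          simp only [j] at h3 ⊢
          linarith
        have hnorm := (hR₀ _ hmem).trans (le_max_left R₀ 0)
        have hcoord := (norm_le_pi_norm _ (⟨(c : ℕ) % 2, Nat.mod_lt _ two_pos⟩ : Fin 2)).trans hnorm
        have hxc : block x j ⟨(c : ℕ) % 2, Nat.mod_lt _ two_pos⟩ = x c := by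
          refine congrArg x (Fin.ext ?_)
          simp only [j]
          omega
        rw [Pi.smul_apply, hxc, norm_smul, norm_inv, Real.norm_of_nonneg (hpow s).le,
          inv_mul_le_iff₀ (hpow s), Real.norm_eq_abs] at hcoord
        rw [hc, mul_comm]
        exact hcoord
  -- the perturbed polygons
  have hngon : ∀ (x : Fin (2 * r) → ℝ) (j : Fin r), (∀ j' : Fin r, (j' : ℕ) < j →
      ∀ i, rowForm (dppMatrix m r d ε g) (j', i) x ≤ t ^ (j' : ℕ) * β i) →
      ∃ w, IsNGon A (fun i => β i - lowerPart g (j, i) x / t ^ (j : ℕ)) w := by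
    intro x j hx
    refine hpert _ fun i => ?_
    rw [sub_sub_cancel_left, abs_neg, abs_div, abs_of_pos (hpow j), div_le_iff₀ (hpow j)]
    exact ht j x (hbound x j hx) i
  refine ⟨fun j => t ^ (j : ℕ), fun j => hpow j, ⟨R * t ^ r, fun x hx => ?_⟩, fun J => ⟨?_, ?_⟩⟩
  · refine (pi_norm_le_iff_of_nonneg (by positivity)).2 fun c => ?_
    have := c.isLt
    refine (hbound x r (fun j _ i => hx (j, i)) c (by omega)).trans ?_
    gcongr
    omega
  · rintro ⟨x, hx⟩ j
    obtain ⟨w, hw⟩ := hngon x j fun j' _ i => hx.1 (j', i)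
    obtain ⟨k, hk⟩ := hw.exists_active_subset hm (x := (t ^ (j : ℕ))⁻¹ • block x j) fun i => by
      have h2 := sub_nonpos.2 (hx.1 (j, i))
      rw [hiff j i x _ (hsmul x j)] at h2
      exact sub_nonpos.1 (nonpos_of_mul_nonpos_right h2 (hpow j))
    refine ⟨k, fun i hi => hk i ?_⟩
    have h2 := sub_eq_zero.2 ((hx.2 (j, i)).2 hi)
    rw [hiff j i x _ (hsmul x j)] at h2
    exact sub_eq_zero.1 ((mul_eq_zero.1 h2).resolve_left (hpow j).ne')
  · -- choose the coordinates block by block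
    intro hJ
    have hrec : ∀ s ≤ r, ∃ x : Fin (2 * r) → ℝ, ∀ j : Fin r, (j : ℕ) < s → ∀ i,
        rowForm (dppMatrix m r d ε g) (j, i) x ≤ t ^ (j : ℕ) * β i ∧
        (rowForm (dppMatrix m r d ε g) (j, i) x = t ^ (j : ℕ) * β i ↔ (j, i) ∈ J) := by
      intro s
      induction s with
      | zero => exact fun _ => ⟨0, fun j hj => absurd hj (Nat.not_lt_zero _)⟩
      | succ s ih =>
        intro hs
        obtain ⟨x, hx⟩ := ih (by omega)
        let j : Fin r := ⟨s, hs⟩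
        obtain ⟨w, hw⟩ := hngon x j fun j' hj' i => (hx j' hj' i).1
        obtain ⟨k, hk⟩ := hJ j
        obtain ⟨y, hy⟩ := hw.exists_hasActiveSet hm
          (J := Finset.univ.filter fun i => (j, i) ∈ J) (k := k)
          fun i hi => hk i (by simpa using hi)
        let x' : Fin (2 * r) → ℝ := fun c =>
          if (c : ℕ) / 2 = s then t ^ s * y ⟨(c : ℕ) % 2, Nat.mod_lt _ two_pos⟩ else x c
        have hlow : ∀ (j' : Fin r) (i : Fin m), (j' : ℕ) ≤ s →
            lowerPart g (j', i) x' = lowerPart g (j', i) x := fun j' i hj' =>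
          lowerPart_congr fun c hc => if_neg (by simp only at hc; omega)
        have hblock : block x' j = t ^ (j : ℕ) • y := by
          funext e
          have he := e.isLt
          have e1 : (2 * s + (e : ℕ)) / 2 = s := by omega
          have e2 : (2 * s + (e : ℕ)) % 2 = e := by omega
          simp only [block, x', j, e1, e2, if_true, Pi.smul_apply, smul_eq_mul]
        refine ⟨x', fun j' hj' i => ?_⟩
        rcases Nat.lt_succ_iff_lt_or_eq.1 hj' with hj' | hj'
        · have hblock' : block x' j' = block x j' := by
            funext e
            have he := e.isLt
            exact if_neg (by simp only; omega)
          have heq : rowForm (dppMatrix m r d ε g) (j', i) x' =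
              rowForm (dppMatrix m r d ε g) (j', i) x := by
            rw [rowForm_dppMatrix, rowForm_dppMatrix, hblock', hlow j' i hj'.le]
          rw [heq]
          exact hx j' hj' i
        · obtain rfl : j' = j := Fin.ext hj'
          have h1 := hiff j i x' y hblock
          rw [hlow j i le_rfl] at h1
          have h2 := hy.1 i
          have h3 := hy.2 i
          simp only [Finset.mem_filter, Finset.mem_univ, true_and] at h3
          rw [← h3, ← sub_nonpos, ← sub_eq_zero, h1]
          refine ⟨mul_nonpos_of_nonneg_of_nonpos (hpow j).le (sub_nonpos.2 h2), ?_⟩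
          rw [mul_eq_zero, or_iff_right (hpow j).ne', sub_eq_zero]
    obtain ⟨x, hx⟩ := hrec r le_rfl
    exact ⟨x, fun p => (hx p.1 p.1.isLt p.2).1, fun p => (hx p.1 p.1.isLt p.2).2⟩

end Deformed

/-! ### Faces preserved by the projection -/

section Projection

variable {m r d : ℕ} {ε : ℝ}

/-- The position of the row of an edge among the limits of the truncated normals: it depends only on
the polygon and on the parity of the edge. -/
def limitIndex (p : Fin r × Fin m) : Fin (2 * r) :=
  ⟨2 * (p.1 : ℕ) + (p.2 : ℕ) % 2, by have := p.1.isLt; omega⟩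

theorem abs_slope_le_one (hm : 4 ≤ m) {i : ℕ} (h0 : 0 < i) (h1 : i < m) : |slope m i| ≤ 1 := by
  rw [abs_le, ← slope_last hm, slope_le_iff hm]
  refine ⟨by omega, ?_⟩
  rw [← slope_one hm, slope_le_iff hm]
  exact h0

theorem abs_polygonMatrix_le (hm : 4 ≤ m) (hε : 0 < ε) (hε1 : ε ≤ 1) {i : Fin m} {e : Fin 2}
    (h : (i : ℕ) % 2 = 0 ∨ e = 1) : |polygonMatrix m ε i e| ≤ ε := by
  have hval : polygonMatrix m ε i e = scale ε i * unscaledMatrix m ε i e := by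
    simp only [polygonMatrix, unscaledMatrix, slope, Pi.smul_apply, smul_eq_mul]
  have hs : |scale ε i| ≤ 1 := by
    rw [abs_of_pos (scale_pos hε i), scale]
    split_ifs
    · exact hε1
    · exact le_rfl
  have hu : |unscaledMatrix m ε i 1| ≤ ε := by
    by_cases h0 : (i : ℕ) = 0
    · simpa [unscaledMatrix, h0] using hε.le
    · have := abs_slope_le_one hm (Nat.pos_of_ne_zero h0) i.isLt
      have h1 : unscaledMatrix m ε i 1 = ε * slope m i := by simp [unscaledMatrix, h0]
      rw [h1, abs_mul, abs_of_pos hε]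
      exact mul_le_of_le_one_right hε.le this
  rw [hval, abs_mul]
  by_cases he : e = 1
  · rw [he]
    exact (mul_le_of_le_one_left (abs_nonneg _) hs).trans hu
  · have h0 : e = 0 := by omega
    have hi : Even (i : ℕ) := Nat.even_iff.2 (h.resolve_right he)
    have hu0 : |unscaledMatrix m ε i 0| ≤ 1 := by
      simp only [unscaledMatrix]
      split_ifs <;> simp
    rw [h0, scale, if_pos hi, abs_of_pos hε]
    exact mul_le_of_le_one_right hε.le hu0

theorem polygonMatrix_odd {i : Fin m} (h : (i : ℕ) % 2 = 1) : polygonMatrix m ε i 0 = 1 := by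
  have h0 : (i : ℕ) ≠ 0 := by omega
  have h1 : ¬ Even (i : ℕ) := by rw [Nat.even_iff]; omega
  simp [polygonMatrix, scale, h0, h1]

theorem limitRows_of_pos (g : Matrix (Fin (d - 1)) (Fin (2 * r - d)) ℝ) {t : Fin (2 * r)}
    (h : 0 < (t : ℕ)) (c : Fin (2 * r - d)) :
    limitRows g t c = stack g ⟨(t : ℕ) - 1, by have := t.isLt; omega⟩ c := dif_neg h.ne'

theorem limitRows_of_le (g : Matrix (Fin (d - 1)) (Fin (2 * r - d)) ℝ) {t : Fin (2 * r)}
    (h : (t : ℕ) ≤ 2 * r - d) (c : Fin (2 * r - d)) :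
    limitRows g t c = if (t : ℕ) = c + 1 then 1 else 0 := by
  rcases Nat.eq_zero_or_pos (t : ℕ) with h0 | h0
  · rw [if_neg (by omega)]
    exact dif_pos h0
  · have hc := c.isLt
    rw [limitRows_of_pos g h0, stack_of_lt g (by simp only; omega)]
    simp only [Nat.sub_eq_iff_eq_add h0]

/-- The truncated normals are close to the rows of the Gale transform. -/
theorem abs_dppMatrix_sub_limitRows_le (hm : 4 ≤ m) (hε : 0 < ε) (hε1 : ε ≤ 1)
    (g : Matrix (Fin (d - 1)) (Fin (2 * r - d)) ℝ) (p : Fin r × Fin m) (c : Fin (2 * r - d)) :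
    |dppMatrix m r d ε g p ⟨c, by omega⟩ - limitRows g (limitIndex p) c| ≤ ε := by
  have hc := c.isLt
  have ht : ((limitIndex p : Fin (2 * r)) : ℕ) = 2 * (p.1 : ℕ) + (p.2 : ℕ) % 2 := rfl
  rcases lt_trichotomy ((c : ℕ) / 2) p.1 with h | h | h
  · -- to the left of the diagonal block, the rows of the Gale transform appear unchanged
    have e : dppMatrix m r d ε g p ⟨c, by omega⟩ = limitRows g (limitIndex p) c := by
      rw [limitRows_of_pos g (by omega)]
      exact (if_neg h.ne).trans (dif_pos ⟨h, hc⟩)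
    rw [e, sub_self, abs_zero]
    exact hε.le
  · -- the diagonal block contributes the identity rows that are cut off there
    have e : dppMatrix m r d ε g p ⟨c, by omega⟩ =
        polygonMatrix m ε p.2 ⟨(c : ℕ) % 2, Nat.mod_lt _ (by norm_num)⟩ := if_pos h
    rw [e, limitRows_of_le g (by omega)]
    by_cases hodd : (p.2 : ℕ) % 2 = 1 ∧ (c : ℕ) % 2 = 0
    · have he : (⟨(c : ℕ) % 2, Nat.mod_lt _ (by norm_num)⟩ : Fin 2) = 0 := Fin.ext hodd.2
      rw [he, polygonMatrix_odd hodd.1, if_pos (by omega), sub_self, abs_zero]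
      exact hε.le
    · rw [if_neg (by omega), sub_zero]
      refine abs_polygonMatrix_le hm hε hε1 ?_
      rw [Fin.ext_iff]
      simp only [Fin.val_one]
      omega
  · have e : dppMatrix m r d ε g p ⟨c, by omega⟩ = 0 :=
      (if_neg h.ne').trans (dif_neg fun h' => h.not_gt h'.1)
    rw [e, limitRows_of_le g (by omega), if_neg (by omega), sub_self, abs_zero]
    exact hε.le

/-- Since `m` is even, two adjacent edges have different parity. -/
theorem injOn_limitIndex [NeZero m] (hm : 4 ≤ m) (hev : Even m) {J : Finset (Fin r × Fin m)}
    (hJ : J ∈ polygonComplex m r) : Set.InjOn limitIndex (J : Set (Fin r × Fin m)) := by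
  rintro ⟨j, i⟩ hp ⟨j', i'⟩ hp' heq
  simp only [limitIndex, Fin.mk.injEq] at heq
  obtain rfl : j = j' := Fin.ext (by omega)
  obtain ⟨k, hk⟩ := hJ j
  have hk1 := fin_val_add_one (by omega) k
  have h2 := Nat.even_iff.1 hev
  have hi := hk i hp
  have hi' := hk i' hp'
  simp only [Fin.ext_iff] at hi hi'
  obtain rfl : i = i' := Fin.ext (by split_ifs at hk1 <;> omega)
  rfl

/-- The projection to the last `d` coordinates as a linear map. -/
def projLastLin {n d : ℕ} (h : d ≤ n) : (Fin n → ℝ) →ₗ[ℝ] (Fin d → ℝ) where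
  toFun := projLast h
  map_add' _ _ := rfl
  map_smul' _ _ := rfl

theorem projLastLin_surjective {n d : ℕ} (h : d ≤ n) : Function.Surjective (projLastLin h) := by
  intro y
  refine ⟨fun c => if hc : n - d ≤ (c : ℕ) then y ⟨(c : ℕ) - (n - d), by omega⟩ else 0, ?_⟩
  funext i
  refine (dif_pos (Nat.le_add_right _ _)).trans (congrArg y (Fin.ext ?_))
  simp

/-- A linear form whose first coefficients vanish factors through the projection. -/
theorem exists_eq_comp_projLastLin {n d : ℕ} (h : d ≤ n) (f : (Fin n → ℝ) →ₗ[ℝ] ℝ)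
    (hf : ∀ c : Fin n, (c : ℕ) < n - d → f (Pi.single c 1) = 0) :
    ∃ l : (Fin d → ℝ) →ₗ[ℝ] ℝ, ∀ x, f x = l (projLastLin h x) := by
  obtain ⟨s, hs⟩ := LinearMap.exists_rightInverse_of_surjective (projLastLin h)
    (LinearMap.range_eq_top.2 (projLastLin_surjective h))
  refine ⟨f ∘ₗ s, fun x => ?_⟩
  have hker : ∀ y, projLastLin h y = 0 → f y = 0 := by
    intro y hy
    rw [← Finset.univ_sum_single y, map_sum]
    refine Finset.sum_eq_zero fun c _ => ?_
    rcases lt_or_ge (c : ℕ) (n - d) with hc | hc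
    · have hyc : Pi.single c (y c) = y c • (Pi.single c 1 : Fin n → ℝ) := by
        rw [← Pi.single_smul, smul_eq_mul, mul_one]
      rw [hyc, map_smul, hf c hc, smul_zero]
    · have hyc : y c = 0 := by
        refine Eq.trans (congrArg y (Fin.ext ?_)) (congrFun hy ⟨(c : ℕ) - (n - d), by omega⟩)
        simp only
        omega
      rw [hyc, Pi.single_zero, map_zero]
  have hsx : projLastLin h (s (projLastLin h x)) = projLastLin h x :=
    LinearMap.congr_fun hs (projLastLin h x)
  have := hker (x - s (projLastLin h x)) (by rw [map_sub, hsx, sub_self])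
  rw [map_sub, sub_eq_zero] at this
  exact this

/-- For small `ε`, all faces of dimension at most `d / 2 - 1` of the deformed product are preserved:
a positive combination of their normals vanishes in the deleted coordinates. -/
theorem exists_isPreserved [NeZero m] (hm : 4 ≤ m) (hev : Even m) (hd : 2 ≤ d) (hdr : d ≤ 2 * r) :
    ∃ ε > 0, ∀ β : Fin r × Fin m → ℝ, ∀ J ∈ polygonComplex m r, 2 * r ≤ J.card + (d / 2 - 1) →
      IsPreserved (rowForm (dppMatrix m r d ε (galeLower r d))) β (projLastLin hdr) J := by
  classical
  obtain ⟨ε₀, hε₀, hdep⟩ := exists_uniform_pos_dependence hd hdr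
  have hε : 0 < min ε₀ 1 := lt_min hε₀ one_pos
  refine ⟨min ε₀ 1, hε, fun β J hJ hcard => ?_⟩
  have hinj := injOn_limitIndex hm hev hJ
  have : Nonempty (Fin r × Fin m) := ⟨⟨0, by omega⟩, 0⟩
  set σ := Function.invFunOn limitIndex (J : Set (Fin r × Fin m)) with hσ
  have hσJ : ∀ p ∈ J, σ (limitIndex p) = p := fun p hp => hinj.leftInvOn_invFunOn hp
  obtain ⟨μ, hμ, hsum⟩ := hdep (J.image limitIndex)
    (by rw [Finset.card_image_of_injOn hinj]; omega)
    (fun t c => dppMatrix m r d (min ε₀ 1) (galeLower r d) (σ t) ⟨c, by omega⟩) (by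
      intro t ht c
      obtain ⟨p, hp, rfl⟩ := Finset.mem_image.1 ht
      simp only [hσJ p hp]
      exact (abs_dppMatrix_sub_limitRows_le hm hε (min_le_right _ _) _ p c).trans (min_le_left _ _))
  obtain ⟨l, hl⟩ := exists_eq_comp_projLastLin hdr
    (∑ p ∈ J, μ (limitIndex p) • rowForm (dppMatrix m r d (min ε₀ 1) (galeLower r d)) p) (by
      intro c hc
      have h1 := hsum ⟨c, hc⟩
      rw [Finset.sum_image hinj] at h1
      rw [LinearMap.sum_apply, ← h1]
      refine Finset.sum_congr rfl fun p hp => ?_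
      rw [hσJ p hp, LinearMap.smul_apply, rowForm_apply, Matrix.mulVec_single_one]
      rfl)
  have hl' : ∀ x, l (projLastLin hdr x) = ∑ p ∈ J,
      μ (limitIndex p) * rowForm (dppMatrix m r d (min ε₀ 1) (galeLower r d)) p x := by
    intro x
    simp [← hl]
  refine ⟨l, ∑ p ∈ J, μ (limitIndex p) * β p, fun x hx => ?_, fun x hx hxJ => ?_⟩
  · rw [hl']
    exact Finset.sum_congr rfl fun p hp => by rw [hx.2 p hp]
  · rw [hl']
    exact sum_smul_lt_of_notMem_hFace (μ := fun p => μ (limitIndex p))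
      (fun p hp => hμ _ (Finset.mem_image_of_mem _ hp)) hx hxJ

end Projection

end PDPP

theorem mainTheorem5 (m r d : ℕ) (hm : 4 ≤ m) (hm_even : Even m) (hd : 2 ≤ d) (hdr : d ≤ 2 * r) :
    ∃ X : Set (Fin d → ℝ),
      PDPP.IsPolytope X ∧ PDPP.polyDim X = d ∧
      PDPP.SkeletonIso (d / 2 - 1) X (PDPP.polygonProduct m r) ∧
      ∃ (Q : Fin (2 * r - 1) → Fin (d - 2) → ℝ) (g : Matrix (Fin (d - 1)) (Fin (2 * r - d)) ℝ)
        (ε : ℝ) (b : Fin m → ℝ) (M : Fin r → ℝ),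
        PDPP.IsNeighborlyGP Q ∧ PDPP.IsGaleTransform Q (PDPP.stack g) ∧
        0 < ε ∧ (∀ i, 0 < b i) ∧ (∀ j, 0 < M j) ∧
        PDPP.IsPolygon m (PDPP.specialPolygon m ε b) ∧
        PDPP.IsPolytope (PDPP.dpp m r d ε g b M) ∧
        PDPP.polyDim (PDPP.dpp m r d ε g b M) = 2 * r ∧
        PDPP.CombEquiv (PDPP.dpp m r d ε g b M) (PDPP.polygonProduct m r) ∧
        X = PDPP.projLast hdr '' PDPP.dpp m r d ε g b M := by
  open PDPP in
  have : NeZero m := ⟨by omega⟩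
  obtain ⟨ε, hε, hpres⟩ := exists_isPreserved hm hm_even hd hdr
  obtain ⟨M, hM, ⟨B, hB⟩, hinc⟩ := exists_hasIncidences_dpp hm hε (galeLower r d)
  have hdpp : dpp m r d ε (galeLower r d) (specialRhs m) M =
      hPolyhedron (rowForm (dppMatrix m r d ε (galeLower r d)))
        fun p => M p.1 * (scale ε p.2 * specialRhs m p.2) := rfl
  have hproj : projLast hdr '' dpp m r d ε (galeLower r d) (specialRhs m) M =
      projLastLin hdr '' dpp m r d ε (galeLower r d) (specialRhs m) M := rfl
  have hpure := isPureComplex_polygonComplex (r := r) hm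
  have hprod := hasIncidences_product (r := r) hm
  obtain ⟨x, hx⟩ := (hinc ∅).2 fun _ => ⟨0, by simp⟩
  have hspan := vectorSpan_hPolyhedron hx
  have hpoly : IsPolytope (dpp m r d ε (galeLower r d) (specialRhs m) M) :=
    isPolytope_hPolyhedron (isCompact_hPolyhedron hB) ⟨x, hx.1⟩
  refine ⟨_, hpoly.image (projLastLin hdr), ?_, ?_, momentPoints (2 * r - 1) (d - 2), galeLower r d,
    ε, specialRhs m, M, isNeighborlyGP_momentPoints _ _, isGaleTransform_galeLower hd hdr, hε,
    specialRhs_pos, hM, (isNGon_special hm hε).isPolygon hm (special_recession hm hε), hpoly,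
    ?_, ?_, hproj.symm⟩
  · rw [polyDim, vectorSpan_image_linearMap, hdpp, hspan, Submodule.map_top,
      LinearMap.range_eq_top.2 (projLastLin_surjective hdr), finrank_top, Module.finrank_fin_fun]
  · rw [polygonProduct_eq hm hm_even]
    exact hinc.skeletonIso_image hprod hpure (by simp)
      (by simp [Module.finrank_pi_fintype, mul_comm]) (by omega)
      (hpres _)
  · rw [polyDim, hdpp, hspan, finrank_top, Module.finrank_fin_fun]
  · rw [polygonProduct_eq hm hm_even]
    exact hinc.combEquiv hprod
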